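/- Let $M$ be a complex manifold of complex dimension $n+1$ with $n\ge 1$, with complex structure $J$ (compactness and connectedness are not needed). Let $(g,\theta)$ be a Vaisman structure on $M$: $g$ is a Hermitian metric, $\theta$ is a 1-form that is parallel for the Levi-Civita connection of $g$, and $\omega(X,Y)=g(X,JY)$ satisfies $d\omega=\theta\wedge\omega$. Assume the normalization $\|\theta\|=1$, and put $\theta^c=\theta\circ J$, $U=\theta^\sharp$ (the Lee field) and $V=(\theta^c)^\sharp$. The canonical foliation $\mathcal F$ is the one spanned by $U,V$, and $Q=\ker\theta\cap\ker\theta^c$ is its orthogonal complement. For a foliation with orthogonal complement $N$, the transverse Ricci tensor is the Ricci tensor on $N$ of the Bott connection, given by $\nabla^T_XY=\pi_N(\nabla_XY)$ for $X\in\Gamma(N)$ and $\nabla^T_XY=\pi_N([X,Y])$ for $X$ tangent to the foliation. The metric $g$ is transversally Kähler–Einstein with constant $c$ if the transverse Ricci tensor of $\mathcal F$ equals $c\,g$ on $Q$. Let $\lambda\in\mathbb R$ with $\lambda+\tfrac12>0$. Then: 1. $g$ is transversally Kähler–Einstein with constant $\lambda+\tfrac12$ if and only if it is generalized quasi-Einstein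 in the sense that $$\operatorname{Ric}_g=\lambda g+\bigl(\tfrac n2-\lambda\bigr)\theta^c\otimes\theta^c-\lambda\,\theta\otimes\theta .$$ 2. If these conditions hold, put $a=\frac{2\lambda+1}{n+1}>0$. Then the $Q$-homothetic deformation $$\tilde g=a\,g+(a^2-a)\,(\theta^c\otimes\theta^c+\theta\otimes\theta)$$ is a Riemannian metric which is again Vaisman (for the same complex structure), with unit Lee form $\tilde\theta=a\theta$. It is transversally Einstein with respect to the distribution $\ker\theta$ complementary to the Lee field: on $\ker\theta$, both the Ricci tensor $\operatorname{Ric}_{\tilde g}$ and the transverse Ricci tensor of the foliation spanned by the Lee field of $\tilde g$ equal $\tfrac n2\,\tilde g$. Moreover $\tilde g$ is quasi-Einstein: $$\operatorname{Ric}_{\tilde g}=\tfrac n2\,\tilde g-\tfrac n2\,\tilde\theta\otimes\tilde\theta .$$ -/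

import Mathlib

open Bundle VectorField
open scoped Manifold ContDiff

noncomputable section

namespace VaismanGeometry

/-! ### Riemannian geometry of a metric field on (an open part of) a vector space

A metric field is a map `h : E → E →L[ℝ] E →L[ℝ] ℝ`; everything below depends only on the germ of
the data at the point under consideration. -/

section Coordinates

variable {E : Type*} [NormedAddCommGroup E] [NormedSpace ℝ E]

/-- The vector `α^♯` dual to the covector `α`: for nondegenerate symmetric `h`, the unique vector
with `h (α^♯) v = α v` for all `v`. -/
def sharp (h : E →L[ℝ] E →L[ℝ] ℝ) (α : E →L[ℝ] ℝ) : E :=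
  ContinuousLinearMap.inverse h α

/-- Christoffel symbols: `Γ(u, v)` is determined by
`2 h(Γ(u, v), w) = (∂_u h)(v, w) + (∂_v h)(u, w) - (∂_w h)(u, v)`. -/
def christoffel (h : E → E →L[ℝ] E →L[ℝ] ℝ) (y u v : E) : E :=
  sharp (h y) ((1 / 2 : ℝ) •
    (fderiv ℝ h y u v + fderiv ℝ h y v u - ((fderiv ℝ h y).flip u).flip v))

/-- The Levi-Civita derivative `∇_X Y` of vector fields. -/
def leviCivita (h : E → E →L[ℝ] E →L[ℝ] ℝ) (X Y : E → E) : E → E :=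
  fun y => fderiv ℝ Y y (X y) + christoffel h y (X y) (Y y)

/-- `R(X, Y)Z = D_X D_Y Z - D_Y D_X Z - D_[X,Y] Z` for an operator `D X Y = D_X Y`. -/
def curvature (D : (E → E) → (E → E) → (E → E)) (X Y Z : E → E) : E → E :=
  fun y => D X (D Y Z) y - D Y (D X Z) y - D (lieBracket ℝ X Y) Z y

/-- The Ricci tensor `Ric(v, w) = tr (u ↦ R(u, v)w)`; tangent vectors at `y` are extended to
constant vector fields. -/
def ricciLocal [FiniteDimensional ℝ E] (h : E → E →L[ℝ] E →L[ℝ] ℝ) (y v w : E) : ℝ :=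
  ∑ i, (Module.finBasis ℝ E).coord i
    (curvature (leviCivita h) (fun _ => Module.finBasis ℝ E i) (fun _ => v) (fun _ => w) y)

/-- The Bott connection of a foliation. Here `P y` is the `h y`-orthogonal projection onto the
orthogonal complement `Q` of the foliation, and `Y` is a section of `Q`. By definition
`∇ᵀ_X Y = P (∇_X Y)` if `X` is a section of `Q` and `∇ᵀ_X Y = P [X, Y]` if `X` is tangent to the
foliation; a general `X` is split as `P X + (X - P X)`. -/
def bott (h : E → E →L[ℝ] E →L[ℝ] ℝ) (P : E → E → E) (X Y : E → E) : E → E :=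
  fun y => P y (leviCivita h (fun z => P z (X z)) Y y)
    + P y (lieBracket ℝ (fun z => X z - P z (X z)) Y y)

/-- The transverse Ricci tensor `Ricᵀ(v, w) = tr_Q (u ↦ Rᵀ(u, v)w)`, for `v w ∈ Q` at `y`, where
`Rᵀ` is the curvature of the Bott connection. The vector `w` is extended to the section `P(·) w`
of `Q`. As `Rᵀ` takes values in `Q`, the trace over `Q` is the trace over `E` of
`u ↦ Rᵀ(P u, v)w`. -/
def transverseRicciLocal [FiniteDimensional ℝ E] (h : E → E →L[ℝ] E →L[ℝ] ℝ) (P : E → E → E)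
    (y v w : E) : ℝ :=
  ∑ i, (Module.finBasis ℝ E).coord i
    (curvature (bott h P) (fun _ => P y (Module.finBasis ℝ E i)) (fun _ => v)
      (fun z => P z w) y)

/-- For a unit 1-form `α`: orthogonal projection onto the complement of the line of `α^♯`. -/
def projLine (h : E → E →L[ℝ] E →L[ℝ] ℝ) (α : E → E →L[ℝ] ℝ) (y v : E) : E :=
  v - α y v • sharp (h y) (α y)

/-- For orthogonal unit 1-forms `α, β`: orthogonal projection onto the complement of the plane
spanned by `α^♯, β^♯`. -/
def projPlane (h : E → E →L[ℝ] E →L[ℝ] ℝ) (α β : E → E →L[ℝ] ℝ) (y v : E) : E :=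
  v - α y v • sharp (h y) (α y) - β y v • sharp (h y) (β y)

/-- Exterior derivative of a 2-form. -/
def dTwoForm (Ω : E → E →L[ℝ] E →L[ℝ] ℝ) (y u v w : E) : ℝ :=
  fderiv ℝ Ω y u v w - fderiv ℝ Ω y v u w + fderiv ℝ Ω y w u v

/-- Wedge product of a covector and an alternating bilinear form. -/
def wedgeOneTwo (α : E →L[ℝ] ℝ) (Ω : E →L[ℝ] E →L[ℝ] ℝ) (u v w : E) : ℝ :=
  α u * Ω v w - α v * Ω u w + α w * Ω u v

/-- The bilinear form `(u, v) ↦ B (A u, A' v)`. -/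
def bilinPull (B : E →L[ℝ] E →L[ℝ] ℝ) (A A' : E →L[ℝ] E) : E →L[ℝ] E →L[ℝ] ℝ :=
  B.bilinearComp A A'

end Coordinates

/-! ### Complex manifolds

A complex manifold is a manifold `M` with holomorphic transition maps, modelled on a complex
vector space `E`. Its charts also make it a smooth real manifold. -/

section Manifold

variable {E : Type*} [NormedAddCommGroup E] [NormedSpace ℂ E]
variable {M : Type*} [TopologicalSpace M] [ChartedSpace E M]

/-- The smooth real manifold underlying a complex manifold. -/
instance realManifold [h : IsManifold 𝓘(ℂ, E) ω M] : IsManifold 𝓘(ℝ, E) ∞ M := by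
  refine isManifold_of_contDiffOn _ _ _ fun e e' he he' => ?_
  have h1 := h.compatible he he'
  rw [contDiffGroupoid, mem_groupoid_of_pregroupoid] at h1
  have h2 : ContDiffOn ℂ ω (e.symm.trans e') (e.symm.trans e').source := by
    simpa [contDiffPregroupoid] using h1.1
  simpa using (h2.restrict_scalars ℝ).of_le le_top

/-- The complex structure `J` on tangent spaces: multiplication by `i` in holomorphic charts. -/
def J (x : M) : TangentSpace 𝓘(ℝ, E) x →L[ℝ] TangentSpace 𝓘(ℝ, E) x :=
  (((Complex.I : ℂ) • ContinuousLinearMap.id ℂ E).restrictScalars ℝ : E →L[ℝ] E)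

variable (E M) in
/-- Fields of covectors (1-forms). -/
abbrev OneForm : Type _ := (x : M) → TangentSpace 𝓘(ℝ, E) x →L[ℝ] ℝ

variable (E M) in
/-- Fields of bilinear forms. -/
abbrev BilinField : Type _ :=
  (x : M) → TangentSpace 𝓘(ℝ, E) x →L[ℝ] TangentSpace 𝓘(ℝ, E) x →L[ℝ] ℝ

/-- Differential at `y` of the inverse of the preferred chart at `x`. -/
def dChartSymm (x : M) (y : E) : E →L[ℝ] TangentSpace 𝓘(ℝ, E) ((chartAt E x).symm y) :=
  mfderiv 𝓘(ℝ, E) 𝓘(ℝ, E) (chartAt E x).symm y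

/-- Differential at `x` of the preferred chart at `x`. -/
def dChart (x : M) : TangentSpace 𝓘(ℝ, E) x →L[ℝ] E :=
  mfderiv 𝓘(ℝ, E) 𝓘(ℝ, E) (chartAt E x) x

/-- Coordinate expression of a 1-form in the preferred chart at `x`. -/
def inChart₁ (α : OneForm E M) (x : M) (y : E) : E →L[ℝ] ℝ :=
  (α ((chartAt E x).symm y)).comp (dChartSymm x y)

/-- Coordinate expression of a field of bilinear forms in the preferred chart at `x`. -/
def inChart₂ (h : BilinField E M) (x : M) (y : E) : E →L[ℝ] E →L[ℝ] ℝ :=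
  bilinPull (E := E) (h ((chartAt E x).symm y)) (dChartSymm x y) (dChartSymm x y)

/-- The anti-Lee form `θᶜ = θ ∘ J`. -/
def antiLee (θ : OneForm E M) : OneForm E M := fun x => (θ x).comp (J x)

/-- The fundamental 2-form `ω(u, v) = g(u, J v)`. -/
def fundamentalForm (g : BilinField E M) : BilinField E M := fun x =>
  bilinPull (E := E) (g x) (ContinuousLinearMap.id ℝ E) (J x)

variable (E M) in
/-- Smooth Riemannian metrics on `M`. -/
abbrev RMetric [IsManifold 𝓘(ℂ, E) ω M] : Type _ :=
  ContMDiffRiemannianMetric 𝓘(ℝ, E) ∞ E (fun x : M => TangentSpace 𝓘(ℝ, E) x)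

/-- `g` is a Vaisman metric on the complex manifold `M` with Lee form `θ`: `g` is Hermitian, `θ` is
a smooth 1-form which is parallel for the Levi-Civita connection of `g`, and `dω = θ ∧ ω`. -/
structure IsVaisman [IsManifold 𝓘(ℂ, E) ω M] (g : RMetric E M) (θ : OneForm E M) : Prop where
  hermitian : ∀ (x : M) (u v : TangentSpace 𝓘(ℝ, E) x),
    g.inner x (J x u) (J x v) = g.inner x u v
  smooth : ContMDiff 𝓘(ℝ, E) (𝓘(ℝ, E).prod 𝓘(ℝ, E →L[ℝ] ℝ)) ∞
    (fun x : M => TotalSpace.mk' (E →L[ℝ] ℝ)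
      (E := fun x : M => TangentSpace 𝓘(ℝ, E) x →L[ℝ] Trivial M ℝ x) x (θ x))
  parallel : ∀ (x : M) (u v : E),
    fderiv ℝ (inChart₁ θ x) (chartAt E x x) u v =
      inChart₁ θ x (chartAt E x x) (christoffel (inChart₂ g.inner x) (chartAt E x x) u v)
  d_fundamentalForm : ∀ (x : M) (u v w : E),
    dTwoForm (inChart₂ (fundamentalForm g.inner) x) (chartAt E x x) u v w =
      wedgeOneTwo (inChart₁ θ x (chartAt E x x))
        (inChart₂ (fundamentalForm g.inner) x (chartAt E x x)) u v w

/-- `‖θ‖ = 1`, that is `θ(θ^♯) = 1` at every point. -/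
def IsUnitForm (g : BilinField E M) (θ : OneForm E M) : Prop :=
  ∀ x : M, θ x (sharp (E := E) (g x) (θ x)) = 1

variable [FiniteDimensional ℂ E]

/-- The Ricci tensor of `g`. -/
def ricci (g : BilinField E M) (x : M) (v w : TangentSpace 𝓘(ℝ, E) x) : ℝ :=
  ricciLocal (inChart₂ g x) (chartAt E x x) (dChart x v) (dChart x w)

/-- The transverse Ricci tensor of the canonical foliation, spanned by `U = θ^♯` and
`V = (θᶜ)^♯`, for a unit form `θ`. -/
def ricciCanonical (g : BilinField E M) (θ : OneForm E M) (x : M)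
    (v w : TangentSpace 𝓘(ℝ, E) x) : ℝ :=
  transverseRicciLocal (inChart₂ g x)
    (projPlane (inChart₂ g x) (inChart₁ θ x) (inChart₁ (antiLee θ) x))
    (chartAt E x x) (dChart x v) (dChart x w)

/-- The transverse Ricci tensor of the foliation spanned by the Lee field `U = θ^♯` alone, for a
unit form `θ`. -/
def ricciLee (g : BilinField E M) (θ : OneForm E M) (x : M)
    (v w : TangentSpace 𝓘(ℝ, E) x) : ℝ :=
  transverseRicciLocal (inChart₂ g x) (projLine (inChart₂ g x) (inChart₁ θ x))
    (chartAt E x x) (dChart x v) (dChart x w)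

/-- `Ricᵀ = c gᵀ` for the canonical foliation; its orthogonal complement is
`Q = ker θ ∩ ker θᶜ`. -/
def IsTransverseKahlerEinstein (g : BilinField E M) (θ : OneForm E M) (c : ℝ) : Prop :=
  ∀ (x : M) (v w : TangentSpace 𝓘(ℝ, E) x), θ x v = 0 → antiLee θ x v = 0 →
    θ x w = 0 → antiLee θ x w = 0 → ricciCanonical g θ x v w = c * g x v w

/-- `Ricᵀ = c gᵀ` for the foliation spanned by the Lee field; its orthogonal complement is
`ker θ`. -/
def IsLeeTransverseEinstein (g : BilinField E M) (θ : OneForm E M) (c : ℝ) : Prop :=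
  ∀ (x : M) (v w : TangentSpace 𝓘(ℝ, E) x), θ x v = 0 → θ x w = 0 →
    ricciLee g θ x v w = c * g x v w

/-- `Ric = c g` on the complement `ker θ` of the Lee field. -/
def IsEinsteinOnLeeComplement (g : BilinField E M) (θ : OneForm E M) (c : ℝ) : Prop :=
  ∀ (x : M) (v w : TangentSpace 𝓘(ℝ, E) x), θ x v = 0 → θ x w = 0 →
    ricci g x v w = c * g x v w

/-- Generalized quasi-Einstein: `Ric = c g + α θᶜ ⊗ θᶜ + β θ ⊗ θ`. -/
def IsGeneralizedQuasiEinstein (g : BilinField E M) (θ : OneForm E M) (c α β : ℝ) : Prop :=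
  ∀ (x : M) (v w : TangentSpace 𝓘(ℝ, E) x),
    ricci g x v w = c * g x v w + α * (antiLee θ x v * antiLee θ x w) + β * (θ x v * θ x w)

/-- Quasi-Einstein: `Ric = c g + β θ ⊗ θ`. -/
def IsQuasiEinstein (g : BilinField E M) (θ : OneForm E M) (c β : ℝ) : Prop :=
  ∀ (x : M) (v w : TangentSpace 𝓘(ℝ, E) x),
    ricci g x v w = c * g x v w + β * (θ x v * θ x w)

/-- `g'` is the Q-homothetic deformation `a g + (a² - a)(θᶜ ⊗ θᶜ + θ ⊗ θ)` of `g`. -/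
def IsQHomotheticDeformation (g g' : BilinField E M) (θ : OneForm E M) (a : ℝ) : Prop :=
  ∀ (x : M) (v w : TangentSpace 𝓘(ℝ, E) x),
    g' x v w = a * g x v w
      + (a ^ 2 - a) * (antiLee θ x v * antiLee θ x w + θ x v * θ x w)

end Manifold

end VaismanGeometry

end

open VaismanGeometry

noncomputable section

namespace VaismanGeometry

set_option synthInstance.maxHeartbeats 400000
set_option maxSynthPendingDepth 5
set_option linter.unusedSectionVars false
set_option linter.unusedSimpArgs false

/-! ### Line derivatives of expressions -/

section LineDeriv

variable {E F G : Type*} [NormedAddCommGroup E] [NormedSpace ℝ E] [NormedAddCommGroup F]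
  [NormedSpace ℝ F] [NormedAddCommGroup G] [NormedSpace ℝ G]

/-! Write U = θ^♯ and V = -JU; the real dimension is 2n + 2. Since θ is parallel, ∇U = 0, hence
R(·,·)U = 0 and Ric(·,U) = 0. Since J is integrable, dω = θ ∧ ω determines ∇J algebraically from g,
θ and J (`christoffel_J`). This gives ∇V = F, where F is J/2 on Q and 0 on the span of U, V. One
more derivative gives R(·,·)V, and its trace is Ric(·,V) = (n/2) θᶜ (`ricciForm_J_lee`). So for
every Vaisman structure with unit Lee form the Ricci tensor is known once one argument is vertical,
and only its restriction to Q is free.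

On sections of Q the Bott connection is the restriction of ∇ + A for an explicit tensor A (`twist`)
built from F, θᶜ and JU. Expanding the curvature of ∇ + A and tracing gives Ricᵀ = Ric + g/2 on Q
(`ricciForm_adaptedMap`), which explains the shift by 1/2 in the Einstein constant. With the
vertical values this proves the equivalence.

The Q-homothetic deformation multiplies g by a on Q and by a² on the vertical plane. It is again
Vaisman with Lee form aθ. It changes ∇ and A by opposite tensors, so ∇ + A is unchanged
(`adaptedMap_deform`), and with it Ricᵀ. The Einstein constant therefore becomes (λ + 1/2)/a, and a
is chosen to make this n/2 + 1/2. The equivalence, applied to the new metric with λ replaced by n/2,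
then has no θᶜ ⊗ θᶜ term: the metric is quasi-Einstein. Finally, as U is parallel, the Bott
connection of the Lee foliation is ∇ itself on sections of ker θ, so its transverse Ricci tensor is
Ric.

The computations take place on an open set of a vector space with constant J. The manifold
definition imposes its equations only at the centre of each preferred chart, and their invariance
under coordinate change extends them to the whole chart (`IsVaisman.localVaisman`). -/

theorem lineDeriv_clm_apply {c : E → F →L[ℝ] G} {c' : F →L[ℝ] G} {f : E → F} {f' : F} {x u : E}
    (hc : HasLineDerivAt ℝ c c' x u) (hf : HasLineDerivAt ℝ f f' x u) :
    HasLineDerivAt ℝ (fun z => c z (f z)) (c' (f x) + c x f') x u := by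
  simpa [HasLineDerivAt] using HasDerivAt.clm_apply (x := (0 : ℝ)) hc hf

theorem lineDeriv_smul {c : E → ℝ} {c' : ℝ} {f : E → F} {f' : F} {x u : E}
    (hc : HasLineDerivAt ℝ c c' x u) (hf : HasLineDerivAt ℝ f f' x u) :
    HasLineDerivAt ℝ (fun z => c z • f z) (c x • f' + c' • f x) x u := by
  simpa [HasLineDerivAt, Pi.smul_def'] using HasDerivAt.smul (x := (0 : ℝ)) hc hf

theorem lineDeriv_add {f g : E → F} {f' g' : F} {x u : E}
    (hf : HasLineDerivAt ℝ f f' x u) (hg : HasLineDerivAt ℝ g g' x u) :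
    HasLineDerivAt ℝ (fun z => f z + g z) (f' + g') x u :=
  HasDerivAt.add (x := (0 : ℝ)) hf hg

theorem lineDeriv_sub {f g : E → F} {f' g' : F} {x u : E}
    (hf : HasLineDerivAt ℝ f f' x u) (hg : HasLineDerivAt ℝ g g' x u) :
    HasLineDerivAt ℝ (fun z => f z - g z) (f' - g') x u :=
  HasDerivAt.sub (x := (0 : ℝ)) hf hg

theorem lineDeriv_const (c : F) (x u : E) : HasLineDerivAt ℝ (fun _ : E => c) 0 x u :=
  hasDerivAt_const (0 : ℝ) c

theorem lineDeriv_of_differentiableAt {f : E → F} {x : E} (hf : DifferentiableAt ℝ f x) (u : E) :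
    HasLineDerivAt ℝ f (fderiv ℝ f x u) x u :=
  hf.hasFDerivAt.hasLineDerivAt u

theorem lineDeriv_clm (L : F →L[ℝ] G) {f : E → F} {f' : F} {x u : E}
    (hf : HasLineDerivAt ℝ f f' x u) : HasLineDerivAt ℝ (fun z => L (f z)) (L f') x u := by
  simpa using lineDeriv_clm_apply (lineDeriv_const L x u) hf

theorem fderiv_apply_eq {f : E → F} {f' : F} {x u : E} (hf : DifferentiableAt ℝ f x)
    (h : HasLineDerivAt ℝ f f' x u) : fderiv ℝ f x u = f' :=
  (hf.hasFDerivAt.hasLineDerivAt u).unique h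

theorem lineDeriv_eq_of_eventuallyEq {f g : E → F} {f' g' : F} {x u : E}
    (hf : HasLineDerivAt ℝ f f' x u) (hg : HasLineDerivAt ℝ g g' x u) (h : f =ᶠ[nhds x] g) :
    f' = g' :=
  hf.unique (hg.congr_of_eventuallyEq h)

end LineDeriv

/-! ### Curvature of a connection d + B on a vector space. -/

section Curvature

variable {E : Type*} [NormedAddCommGroup E] [NormedSpace ℝ E]

/-- The connection `d + B` on the trivial bundle with fibre `E`. -/
def connDeriv (B : E → E →L[ℝ] E →L[ℝ] E) (X Y : E → E) : E → E :=
  fun y => fderiv ℝ Y y (X y) + B y (X y) (Y y)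

/-- The map `u ↦ R(u, v)w` for the curvature `R` of `d + B`. -/
def curvatureMap (B : E → E →L[ℝ] E →L[ℝ] E) (y v w : E) : E →L[ℝ] E :=
  ((fderiv ℝ B y).flip v).flip w - (fderiv ℝ B y v).flip w + (B y).flip (B y v w)
    - (B y v).comp ((B y).flip w)

theorem curvatureMap_apply (B : E → E →L[ℝ] E →L[ℝ] E) (y u v w : E) :
    curvatureMap B y v w u = fderiv ℝ B y u v w - fderiv ℝ B y v u w + B y u (B y v w)
      - B y v (B y u w) := by
  simp [curvatureMap]

theorem curvatureMap_swap (B : E → E →L[ℝ] E →L[ℝ] E) (y u v w : E) :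
    curvatureMap B y v w u = - curvatureMap B y u w v := by
  simp only [curvatureMap_apply]; abel

theorem connDeriv_connDeriv {B : E → E →L[ℝ] E →L[ℝ] E} {Z : E → E} {y : E}
    (hB : DifferentiableAt ℝ B y) (hZ : ContDiffAt ℝ 2 Z y) (u v : E) :
    connDeriv B (fun _ => u) (connDeriv B (fun _ => v) Z) y
      = fderiv ℝ (fderiv ℝ Z) y u v + fderiv ℝ B y u v (Z y) + B y v (fderiv ℝ Z y u)
        + B y u (fderiv ℝ Z y v + B y v (Z y)) := by
  have hZ1 : DifferentiableAt ℝ Z y := hZ.differentiableAt (by norm_num)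
  have hZ2 : DifferentiableAt ℝ (fderiv ℝ Z) y :=
    (hZ.fderiv_right (m := 1) (by norm_num)).differentiableAt (by norm_num)
  have key := lineDeriv_add
    (lineDeriv_clm_apply (lineDeriv_of_differentiableAt hZ2 u) (lineDeriv_const v y u))
    (lineDeriv_clm_apply
      (lineDeriv_clm_apply (lineDeriv_of_differentiableAt hB u) (lineDeriv_const v y u))
      (lineDeriv_of_differentiableAt hZ1 u))
  have hd : DifferentiableAt ℝ (fun z => fderiv ℝ Z z v + B z v (Z z)) y := by fun_prop
  have := fderiv_apply_eq hd key
  change fderiv ℝ (fun z => fderiv ℝ Z z v + B z v (Z z)) y u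
    + B y u (fderiv ℝ Z y v + B y v (Z y)) = _
  rw [this]
  simp only [map_zero, add_zero]
  abel

/-- Agreement of `D` with d + B is asked only along the given field, because the Bott connection is
meaningful only on sections of Q. Constant fields have zero bracket, and the second derivatives of
`Z` cancel by symmetry. -/
theorem curvature_const_eq {D : (E → E) → (E → E) → (E → E)} {B : E → E →L[ℝ] E →L[ℝ] E}
    {Z : E → E} {y : E} (hB : DifferentiableAt ℝ B y) (hZ : ContDiffAt ℝ 2 Z y)
    (hD : ∀ u v, D (fun _ => u) (D (fun _ => v) Z) y
      = connDeriv B (fun _ => u) (connDeriv B (fun _ => v) Z) y)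
    (h0 : D (fun _ => 0) Z y = 0) (u v : E) :
    curvature D (fun _ => u) (fun _ => v) Z y = curvatureMap B y v (Z y) u := by
  have hb : lieBracket ℝ (fun _ : E => u) (fun _ => v) = fun _ => 0 := by
    ext z; simp [lieBracket]
  have hs : fderiv ℝ (fderiv ℝ Z) y u v = fderiv ℝ (fderiv ℝ Z) y v u :=
    hZ.isSymmSndFDerivAt (by simp) u v
  rw [curvature, hb, h0, hD, hD, connDeriv_connDeriv hB hZ, connDeriv_connDeriv hB hZ,
    curvatureMap_apply, hs]
  simp only [map_add]
  abel

/-- For ∇ = d + B torsion-free, the curvature of ∇ + A is R plus the antisymmetrised ∇A plus the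
commutator of A. The terms `A y (B y u v) w` and `A y (B y v u) w` cancel; they are included to make
both brackets covariant derivatives of A. -/
theorem curvatureMap_add {B A : E → E →L[ℝ] E →L[ℝ] E} {y : E}
    (hB : DifferentiableAt ℝ B y) (hA : DifferentiableAt ℝ A y) (hsymm : ∀ u v, B y u v = B y v u)
    (u v w : E) :
    curvatureMap (fun z => B z + A z) y v w u = curvatureMap B y v w u
      + (fderiv ℝ A y u v w + B y u (A y v w) - A y (B y u v) w - A y v (B y u w))
      - (fderiv ℝ A y v u w + B y v (A y u w) - A y (B y v u) w - A y u (B y v w))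
      + (A y u (A y v w) - A y v (A y u w)) := by
  simp only [curvatureMap_apply, fderiv_fun_add hB hA, add_apply, map_add,
    hsymm v u]
  abel

end Curvature

/-! ### Levi-Civita connection of a local metric. -/

section Metric

variable {E : Type*} [NormedAddCommGroup E] [NormedSpace ℝ E]

/-- A smooth Riemannian metric on an open subset of a vector space. -/
structure LocalMetric (h : E → E →L[ℝ] E →L[ℝ] ℝ) (s : Set E) : Prop where
  isOpen : IsOpen s
  smooth : ContDiffOn ℝ ∞ h s
  symm : ∀ y ∈ s, ∀ u v, h y u v = h y v u
  pos : ∀ y ∈ s, ∀ u, u ≠ 0 → 0 < h y u u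

/-- The first-order part of the Koszul formula as a bilinear map. -/
def koszul : (E →L[ℝ] E →L[ℝ] E →L[ℝ] ℝ) →L[ℝ] (E →L[ℝ] E →L[ℝ] E →L[ℝ] ℝ) :=
  (1 / 2 : ℝ) • (ContinuousLinearMap.id ℝ _
    + (ContinuousLinearMap.flipₗᵢ ℝ E E (E →L[ℝ] ℝ)).toContinuousLinearEquiv.toContinuousLinearMap
    - (ContinuousLinearMap.compL ℝ E (E →L[ℝ] E →L[ℝ] ℝ) (E →L[ℝ] E →L[ℝ] ℝ)
        (ContinuousLinearMap.flipₗᵢ ℝ E E ℝ).toContinuousLinearEquiv.toContinuousLinearMap).comp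
      (ContinuousLinearMap.flipₗᵢ ℝ E E (E →L[ℝ] ℝ)).toContinuousLinearEquiv.toContinuousLinearMap)

theorem koszul_apply (T : E →L[ℝ] E →L[ℝ] E →L[ℝ] ℝ) (u v : E) :
    koszul T u v = (1 / 2 : ℝ) • (T u v + T v u - (T.flip u).flip v) := by
  ext w
  simp [koszul]

/-- The Christoffel symbols as a bilinear map. -/
def christoffelMap (h : E → E →L[ℝ] E →L[ℝ] ℝ) (y : E) : E →L[ℝ] E →L[ℝ] E :=
  (ContinuousLinearMap.compL ℝ E (E →L[ℝ] ℝ) E (ContinuousLinearMap.inverse (h y))).comp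
    (koszul (fderiv ℝ h y))

theorem christoffelMap_apply (h : E → E →L[ℝ] E →L[ℝ] ℝ) (y u v : E) :
    christoffelMap h y u v = christoffel h y u v := by
  simp [christoffelMap, christoffel, sharp, koszul_apply]

theorem leviCivita_eq (h : E → E →L[ℝ] E →L[ℝ] ℝ) :
    leviCivita h = connDeriv (christoffelMap h) := by
  ext X Y y
  simp only [leviCivita, connDeriv, christoffelMap_apply]

theorem isInvertible_of_pos [FiniteDimensional ℝ E] {B : E →L[ℝ] E →L[ℝ] ℝ}
    (hB : ∀ u, u ≠ 0 → 0 < B u u) : B.IsInvertible := by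
  have hinj : Function.Injective B.toLinearMap := by
    rw [injective_iff_map_eq_zero]
    intro u hu
    by_contra h0
    have h1 := hB u h0
    have h2 : B u = 0 := hu
    simp [h2] at h1
  have hf : Module.finrank ℝ E = Module.finrank ℝ (E →L[ℝ] ℝ) := by
    rw [← (LinearMap.toContinuousLinearMap (𝕜 := ℝ) (E := E) (F' := ℝ)).finrank_eq]
    exact (Subspace.dual_finrank_eq (K := ℝ) (V := E)).symm
  refine ⟨(LinearEquiv.ofInjectiveOfFinrankEq B.toLinearMap hinj hf).toContinuousLinearEquiv, ?_⟩
  ext u v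
  rfl

theorem sharp_spec [FiniteDimensional ℝ E] {B : E →L[ℝ] E →L[ℝ] ℝ}
    (hB : ∀ u, u ≠ 0 → 0 < B u u) (α : E →L[ℝ] ℝ) (v : E) : B (sharp B α) v = α v := by
  rw [sharp, ContinuousLinearMap.IsInvertible.self_apply_inverse (isInvertible_of_pos hB)]

theorem eq_sharp [FiniteDimensional ℝ E] {B : E →L[ℝ] E →L[ℝ] ℝ}
    (hB : ∀ u, u ≠ 0 → 0 < B u u) {α : E →L[ℝ] ℝ} {z : E} (h : ∀ v, B z v = α v) :
    z = sharp B α := by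
  have : B z = α := ContinuousLinearMap.ext h
  rw [sharp, ← this, ContinuousLinearMap.IsInvertible.inverse_apply_self (isInvertible_of_pos hB)]

variable {h : E → E →L[ℝ] E →L[ℝ] ℝ} {s : Set E} {y : E}

namespace LocalMetric

theorem eq_of_inner (H : LocalMetric h s) (hy : y ∈ s) {u v : E} (huv : ∀ w, h y u w = h y v w) :
    u = v := by
  by_contra hne
  have h1 := H.pos y hy (u - v) (sub_ne_zero.2 hne)
  have h2 := huv (u - v)
  simp only [map_sub, sub_apply] at h1 h2
  linarith

theorem contDiffAt (H : LocalMetric h s) (hy : y ∈ s) : ContDiffAt ℝ ∞ h y :=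
  H.smooth.contDiffAt (H.isOpen.mem_nhds hy)

theorem differentiableAt (H : LocalMetric h s) (hy : y ∈ s) : DifferentiableAt ℝ h y :=
  (H.contDiffAt hy).differentiableAt (by simp)

theorem lineDeriv_apply (H : LocalMetric h s) (hy : y ∈ s) (u v w : E) :
    HasLineDerivAt ℝ (fun z => h z v w) (fderiv ℝ h y u v w) y u := by
  simpa using lineDeriv_clm_apply (lineDeriv_clm_apply
    (lineDeriv_of_differentiableAt (H.differentiableAt hy) u) (lineDeriv_const v y u))
    (lineDeriv_const w y u)

theorem fderiv_symm (H : LocalMetric h s) (hy : y ∈ s) (u v w : E) :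
    fderiv ℝ h y u v w = fderiv ℝ h y u w v :=
  lineDeriv_eq_of_eventuallyEq (H.lineDeriv_apply hy u v w) (H.lineDeriv_apply hy u w v)
    (by filter_upwards [H.isOpen.mem_nhds hy] with z hz using H.symm z hz v w)

variable [FiniteDimensional ℝ E]

theorem inner_sharp (H : LocalMetric h s) (hy : y ∈ s) (α : E →L[ℝ] ℝ) (v : E) :
    h y (sharp (h y) α) v = α v :=
  sharp_spec (H.pos y hy) α v

theorem contDiffAt_inverse (H : LocalMetric h s) (hy : y ∈ s) :
    ContDiffAt ℝ ∞ (fun z => ContinuousLinearMap.inverse (h z)) y :=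
  haveI : CompleteSpace E := FiniteDimensional.complete ℝ E
  ((isInvertible_of_pos (H.pos y hy)).contDiffAt_map_inverse).comp y (H.contDiffAt hy)

theorem contDiffAt_sharp (H : LocalMetric h s) (hy : y ∈ s) {α : E → E →L[ℝ] ℝ}
    (hα : ContDiffAt ℝ ∞ α y) : ContDiffAt ℝ ∞ (fun z => sharp (h z) (α z)) y :=
  (H.contDiffAt_inverse hy).clm_apply hα

theorem contDiffAt_christoffelMap (H : LocalMetric h s) (hy : y ∈ s) :
    ContDiffAt ℝ ∞ (christoffelMap h) y := by
  have h1 : ContDiffAt ℝ ∞ (fun z => koszul (fderiv ℝ h z)) y :=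
    koszul.contDiff.contDiffAt.comp y ((H.contDiffAt hy).fderiv_right (by simp))
  have h2 := (ContinuousLinearMap.compL ℝ E (E →L[ℝ] ℝ) E).contDiff.contDiffAt.comp y
    (H.contDiffAt_inverse hy) (n := ∞)
  exact h2.clm_comp h1

theorem two_inner_christoffel (H : LocalMetric h s) (hy : y ∈ s) (u v w : E) :
    2 * h y (christoffelMap h y u v) w
      = fderiv ℝ h y u v w + fderiv ℝ h y v u w - fderiv ℝ h y w u v := by
  rw [christoffelMap_apply, christoffel, H.inner_sharp hy]
  simp

theorem christoffel_eq_of (H : LocalMetric h s) (hy : y ∈ s) {u v z : E}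
    (hz : ∀ w, 2 * h y z w = fderiv ℝ h y u v w + fderiv ℝ h y v u w - fderiv ℝ h y w u v) :
    christoffelMap h y u v = z :=
  H.eq_of_inner hy fun w => by linarith [hz w, H.two_inner_christoffel hy u v w]

theorem christoffel_symm (H : LocalMetric h s) (hy : y ∈ s) (u v : E) :
    christoffelMap h y u v = christoffelMap h y v u :=
  H.christoffel_eq_of hy fun w => by
    rw [H.two_inner_christoffel hy, H.fderiv_symm hy w u v]; ring

theorem fderiv_eq (H : LocalMetric h s) (hy : y ∈ s) (u v w : E) :
    fderiv ℝ h y u v w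
      = h y (christoffelMap h y u v) w + h y v (christoffelMap h y u w) := by
  have h1 := H.two_inner_christoffel hy u v w
  have h2 := H.two_inner_christoffel hy u w v
  rw [H.symm y hy v]
  linarith [H.fderiv_symm hy u v w, H.fderiv_symm hy v u w, H.fderiv_symm hy w u v]

theorem differentiableAt_christoffelMap (H : LocalMetric h s) (hy : y ∈ s) :
    DifferentiableAt ℝ (christoffelMap h) y :=
  (H.contDiffAt_christoffelMap hy).differentiableAt (by simp)

theorem lineDeriv_christoffel (H : LocalMetric h s) (hy : y ∈ s) (u v w : E) :
    HasLineDerivAt ℝ (fun z => christoffelMap h z v w) (fderiv ℝ (christoffelMap h) y u v w) y u := by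
  simpa using lineDeriv_clm_apply (lineDeriv_clm_apply
    (lineDeriv_of_differentiableAt (H.differentiableAt_christoffelMap hy) u)
    (lineDeriv_const v y u)) (lineDeriv_const w y u)

theorem fderiv_christoffel_symm (H : LocalMetric h s) (hy : y ∈ s) (u v w : E) :
    fderiv ℝ (christoffelMap h) y u v w = fderiv ℝ (christoffelMap h) y u w v :=
  lineDeriv_eq_of_eventuallyEq (H.lineDeriv_christoffel hy u v w) (H.lineDeriv_christoffel hy u w v)
    (by filter_upwards [H.isOpen.mem_nhds hy] with z hz using H.christoffel_symm hz v w)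

theorem bianchi (H : LocalMetric h s) (hy : y ∈ s) (u v w : E) :
    curvatureMap (christoffelMap h) y v w u + curvatureMap (christoffelMap h) y w u v
      + curvatureMap (christoffelMap h) y u v w = 0 := by
  simp only [curvatureMap_apply]
  rw [H.christoffel_symm hy w u, H.christoffel_symm hy v u, H.christoffel_symm hy w v,
    H.fderiv_christoffel_symm hy v w u, H.fderiv_christoffel_symm hy u v w,
    H.fderiv_christoffel_symm hy w u v]
  abel

/-- The second derivatives of `q ↦ h q w z` commute. Expanding both orders by metric compatibility,
the mixed terms cancel and the skewness of R(u, v) is what remains. -/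
theorem inner_curvature_skew (H : LocalMetric h s) (hy : y ∈ s) (u v w z : E) :
    h y (curvatureMap (christoffelMap h) y v w u) z
      = - h y w (curvatureMap (christoffelMap h) y v z u) := by
  have hC : ContDiffAt ℝ 2 (fun q => h q w z) y :=
    (((H.contDiffAt hy).clm_apply contDiffAt_const).clm_apply contDiffAt_const).of_le (by exact WithTop.coe_le_coe.2 (le_top (a := (2 : ℕ∞))))
  have hs := hC.isSymmSndFDerivAt (by simp) u v
  have h2 : DifferentiableAt ℝ (fderiv ℝ (fun q => h q w z)) y :=
    (hC.fderiv_right (m := 1) (by norm_num)).differentiableAt (by norm_num)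
  have key : ∀ a b, fderiv ℝ (fderiv ℝ (fun q => h q w z)) y a b
      = (h y (christoffelMap h y a (christoffelMap h y b w)) z
          + h y (christoffelMap h y b w) (christoffelMap h y a z)
          + h y (fderiv ℝ (christoffelMap h) y a b w) z)
        + (h y (christoffelMap h y a w) (christoffelMap h y b z)
          + h y w (christoffelMap h y a (christoffelMap h y b z))
          + h y w (fderiv ℝ (christoffelMap h) y a b z)) := by
    intro a b
    have e1 : HasLineDerivAt ℝ (fun q => fderiv ℝ (fun q => h q w z) q b)
        (fderiv ℝ (fderiv ℝ (fun q => h q w z)) y a b) y a := by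
      simpa using lineDeriv_clm_apply (lineDeriv_of_differentiableAt h2 a) (lineDeriv_const b y a)
    have hh := lineDeriv_of_differentiableAt (H.differentiableAt hy) a
    have e2 := lineDeriv_add
      (lineDeriv_clm_apply (lineDeriv_clm_apply hh (H.lineDeriv_christoffel hy a b w))
        (lineDeriv_const z y a))
      (lineDeriv_clm_apply (lineDeriv_clm_apply hh (lineDeriv_const w y a))
        (H.lineDeriv_christoffel hy a b z))
    have e3 := lineDeriv_eq_of_eventuallyEq e1 e2 (by
      filter_upwards [H.isOpen.mem_nhds hy] with q hq
      have hd : DifferentiableAt ℝ (fun q => h q w z) q := by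
        have := H.differentiableAt hq
        fun_prop
      rw [fderiv_apply_eq hd (H.lineDeriv_apply hq b w z), H.fderiv_eq hq])
    rw [e3]
    simp only [map_zero, add_zero, add_apply, H.fderiv_eq hy]
  rw [key, key] at hs
  simp only [curvatureMap_apply, map_add, map_sub, add_apply,
    sub_apply]
  linarith

end LocalMetric

end Metric

/-! ### Traces of endomorphisms and symmetry of the Ricci tensor. -/

section Trace

variable {E : Type*} [NormedAddCommGroup E] [NormedSpace ℝ E] [FiniteDimensional ℝ E]

/-- The trace of an endomorphism, given as a plain function. -/
def opTrace (f : E → E) : ℝ :=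
  ∑ i, (Module.finBasis ℝ E).coord i (f (Module.finBasis ℝ E i))

theorem opTrace_add (f g : E → E) : opTrace (fun u => f u + g u) = opTrace f + opTrace g := by
  simp [opTrace, Finset.sum_add_distrib]

theorem opTrace_sub (f g : E → E) : opTrace (fun u => f u - g u) = opTrace f - opTrace g := by
  simp [opTrace, Finset.sum_sub_distrib]

theorem opTrace_smul (c : ℝ) (f : E → E) : opTrace (fun u => c • f u) = c * opTrace f := by
  simp [opTrace, Finset.mul_sum]

theorem opTrace_zero : opTrace (fun _ : E => (0 : E)) = 0 := by simp [opTrace]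

theorem opTrace_rankOne (α : E →L[ℝ] ℝ) (z : E) : opTrace (fun u => α u • z) = α z := by
  conv_rhs => rw [← (Module.finBasis ℝ E).sum_repr z]
  simp only [opTrace, map_sum, map_smul, smul_eq_mul, Module.Basis.coord_apply]
  exact Finset.sum_congr rfl fun i _ => mul_comm _ _

theorem opTrace_eq_trace (L : E →ₗ[ℝ] E) : opTrace L = LinearMap.trace ℝ E L := by
  rw [LinearMap.trace_eq_matrix_trace ℝ (Module.finBasis ℝ E), Matrix.trace]
  simp [opTrace, LinearMap.toMatrix_apply]

theorem opTrace_id : opTrace (fun u : E => u) = Module.finrank ℝ E := by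
  rw [← LinearMap.trace_id ℝ E, ← opTrace_eq_trace]
  rfl

theorem opTrace_comp_comm (L P : E →ₗ[ℝ] E) :
    opTrace (fun u => L (P u)) = opTrace (fun u => P (L u)) := by
  have h1 := opTrace_eq_trace (L ∘ₗ P)
  have h2 := opTrace_eq_trace (P ∘ₗ L)
  rw [LinearMap.trace_comp_comm' L P] at h2
  exact h1.trans h2.symm

/-- The isomorphism with the dual given by `B` conjugates `L` to minus its transpose, and a
transpose has the same trace. -/
theorem opTrace_skew {B : E →L[ℝ] E →L[ℝ] ℝ} (hB : ∀ u, u ≠ 0 → 0 < B u u) (L : E →L[ℝ] E)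
    (hL : ∀ u v, B (L u) v = - B u (L v)) : opTrace L = 0 := by
  obtain ⟨e, he⟩ := isInvertible_of_pos hB
  let e' : E ≃ₗ[ℝ] Module.Dual ℝ E :=
    e.toLinearEquiv.trans (LinearMap.toContinuousLinearMap (𝕜 := ℝ) (E := E) (F' := ℝ)).symm
  have he' : ∀ u v, e' u v = B u v := by
    intro u v; rw [← he]; rfl
  have hc : e'.conj L.toLinearMap = - Module.Dual.transpose (R := ℝ) L.toLinearMap := by
    refine LinearMap.ext fun α => ?_
    obtain ⟨u, rfl⟩ := e'.surjective α
    refine LinearMap.ext fun v => ?_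
    have : e' (L u) v = - e' u (L v) := by rw [he', he', hL]
    simpa [LinearEquiv.conj_apply, Module.Dual.transpose_apply] using this
  have h1 := LinearMap.trace_conj' L.toLinearMap e'
  rw [hc, map_neg, LinearMap.trace_transpose'] at h1
  have h2 := opTrace_eq_trace L.toLinearMap
  change opTrace L = _ at h2
  linarith

/-- The Ricci contraction of the curvature of `d + B`. -/
def ricciForm (B : E → E →L[ℝ] E →L[ℝ] E) (y v w : E) : ℝ :=
  opTrace (curvatureMap B y v w)

variable {h : E → E →L[ℝ] E →L[ℝ] ℝ} {s : Set E} {y : E}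

theorem LocalMetric.ricciLocal_eq (H : LocalMetric h s) (hy : y ∈ s) (v w : E) :
    ricciLocal h y v w = ricciForm (christoffelMap h) y v w := by
  refine Finset.sum_congr rfl fun i _ => ?_
  rw [leviCivita_eq, curvature_const_eq (B := christoffelMap h) (y := y)
    (H.differentiableAt_christoffelMap hy) contDiffAt_const (fun _ _ => rfl) (by simp [connDeriv])]

/-- By the Bianchi identity the two sides differ, up to sign, by the trace of R(v, w), which is skew
for the metric. -/
theorem LocalMetric.ricciForm_symm (H : LocalMetric h s) (hy : y ∈ s) (v w : E) :
    ricciForm (christoffelMap h) y v w = ricciForm (christoffelMap h) y w v := by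
  set C := curvatureMap (christoffelMap h) y with hC
  have hL : ∀ u, (C w v - C v w) u = C w u v := fun u => by
    have h1 := H.bianchi hy u v w
    have h2 := curvatureMap_swap (christoffelMap h) y w u v
    rw [← hC] at h1 h2
    rw [h2, add_assoc, add_comm, add_assoc, add_eq_zero_iff_eq_neg] at h1
    rw [sub_apply, h1]
    abel
  have h0 : opTrace (C w v - C v w) = 0 := by
    refine opTrace_skew (H.pos y hy) _ fun u z => ?_
    rw [hL, hL, hC, H.inner_curvature_skew hy]
  have h3 := opTrace_sub (C w v) (C v w)
  have h4 : opTrace (C w v - C v w) = opTrace fun u => C w v u - C v w u := rfl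
  rw [ricciForm, ricciForm, ← hC]
  linarith

end Trace

/-! ### Pointwise algebra of a Vaisman structure. -/

section Vaisman

variable {E : Type*} [NormedAddCommGroup E] [NormedSpace ℝ E]

/-- A Vaisman structure with unit Lee form on an open subset of a vector space with constant
complex structure `J`. -/
structure LocalVaisman (h : E → E →L[ℝ] E →L[ℝ] ℝ) (θ : E → E →L[ℝ] ℝ) (J : E →L[ℝ] E)
    (s : Set E) : Prop extends LocalMetric h s where
  smooth_form : ContDiffOn ℝ ∞ θ s
  J_sq : ∀ u, J (J u) = -u
  hermitian : ∀ y ∈ s, ∀ u v, h y (J u) (J v) = h y u v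
  parallel : ∀ y ∈ s, ∀ u v, fderiv ℝ θ y u v = θ y (christoffel h y u v)
  d_fundamental : ∀ y ∈ s, ∀ u v w,
    dTwoForm (fun z => bilinPull (h z) (ContinuousLinearMap.id ℝ E) J) y u v w
      = wedgeOneTwo (θ y) (bilinPull (h y) (ContinuousLinearMap.id ℝ E) J) u v w
  unit : ∀ y ∈ s, θ y (sharp (h y) (θ y)) = 1

/-- The Lee field `θ^♯`. -/
def leeField (h : E → E →L[ℝ] E →L[ℝ] ℝ) (θ : E → E →L[ℝ] ℝ) (y : E) : E := sharp (h y) (θ y)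

/-- The endomorphism `u ↦ ∇_u V` for the anti-Lee field `V = -J U`. -/
def antiLeeShape (h : E → E →L[ℝ] E →L[ℝ] ℝ) (θ : E → E →L[ℝ] ℝ) (J : E →L[ℝ] E) (y : E) :
    E →L[ℝ] E :=
  (1 / 2 : ℝ) • (J - (θ y).smulRight (J (leeField h θ y))
    - ((θ y).comp J).smulRight (leeField h θ y))

/-- The covariant derivative `(∇_u J) v`. -/
def covJ (h : E → E →L[ℝ] E →L[ℝ] ℝ) (θ : E → E →L[ℝ] ℝ) (J : E →L[ℝ] E) (y u v : E) : E :=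
  (1 / 2 : ℝ) • (θ y (J v) • u - h y u (J v) • leeField h θ y - θ y v • J u
    + h y u v • J (leeField h θ y))

/-- The covariant derivative `(∇_u F) v` of `F = antiLeeShape`. -/
def covShape (h : E → E →L[ℝ] E →L[ℝ] ℝ) (θ : E → E →L[ℝ] ℝ) (J : E →L[ℝ] E) (y u v : E) : E :=
  (1 / 2 : ℝ) • (covJ h θ J y u v + θ y v • antiLeeShape h θ J y u
    - h y (antiLeeShape h θ J y u) v • leeField h θ y)

variable [FiniteDimensional ℝ E]

/-- A bilinear map on a finite-dimensional space as a continuous bilinear map. -/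
def toBilinMap (f : E →ₗ[ℝ] E →ₗ[ℝ] E) : E →L[ℝ] E →L[ℝ] E :=
  LinearMap.toContinuousLinearMap
    ((LinearMap.toContinuousLinearMap (𝕜 := ℝ) (E := E) (F' := E)).toLinearMap ∘ₗ f)

/-- The difference between the connection preserving the canonical foliation and its complement
and the Levi-Civita connection. -/
def twist (h : E → E →L[ℝ] E →L[ℝ] ℝ) (θ : E → E →L[ℝ] ℝ) (J : E →L[ℝ] E) (y : E) :
    E →L[ℝ] E →L[ℝ] E :=
  toBilinMap (LinearMap.mk₂ ℝ (fun u v => -h y (antiLeeShape h θ J y u) v • J (leeField h θ y)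
      - θ y (J u) • antiLeeShape h θ J y v - θ y (J v) • antiLeeShape h θ J y u)
    (by intros; simp only [map_add, add_apply]; module)
    (by intros; simp only [map_smul, smul_apply, smul_eq_mul]; module)
    (by intros; simp only [map_add]; module)
    (by intros; simp only [map_smul, smul_eq_mul]; module))

variable {h : E → E →L[ℝ] E →L[ℝ] ℝ} {θ : E → E →L[ℝ] ℝ} {J : E →L[ℝ] E} {s : Set E} {y : E}

theorem twist_apply (y u v : E) : twist h θ J y u v
    = -h y (antiLeeShape h θ J y u) v • J (leeField h θ y)
      - θ y (J u) • antiLeeShape h θ J y v - θ y (J v) • antiLeeShape h θ J y u := rfl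

theorem antiLeeShape_apply (y u : E) : antiLeeShape h θ J y u
    = (1 / 2 : ℝ) • (J u - θ y u • J (leeField h θ y) - θ y (J u) • leeField h θ y) := by
  simp [antiLeeShape]

namespace LocalVaisman

theorem inner_lee (H : LocalVaisman h θ J s) (hy : y ∈ s) (v : E) :
    h y (leeField h θ y) v = θ y v := H.inner_sharp hy _ v

theorem inner_lee' (H : LocalVaisman h θ J s) (hy : y ∈ s) (v : E) :
    h y v (leeField h θ y) = θ y v := by rw [H.symm y hy, H.inner_lee hy]

theorem inner_J_left (H : LocalVaisman h θ J s) (hy : y ∈ s) (u v : E) :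
    h y (J u) v = - h y u (J v) := by
  have := H.hermitian y hy u (J v)
  rw [H.J_sq, map_neg] at this
  linarith

theorem inner_J_lee (H : LocalVaisman h θ J s) (hy : y ∈ s) (v : E) :
    h y (J (leeField h θ y)) v = - θ y (J v) := by
  rw [H.inner_J_left hy, H.inner_lee hy]

theorem inner_J_lee' (H : LocalVaisman h θ J s) (hy : y ∈ s) (v : E) :
    h y v (J (leeField h θ y)) = - θ y (J v) := by
  rw [H.symm y hy, H.inner_J_lee hy]

theorem form_lee (H : LocalVaisman h θ J s) (hy : y ∈ s) : θ y (leeField h θ y) = 1 := H.unit y hy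

theorem form_J_lee (H : LocalVaisman h θ J s) (hy : y ∈ s) : θ y (J (leeField h θ y)) = 0 := by
  have h1 := H.inner_J_lee hy (leeField h θ y)
  rw [H.inner_lee' hy] at h1
  linarith

theorem inner_J_self_swap (H : LocalVaisman h θ J s) (hy : y ∈ s) (u v : E) :
    h y u (J v) = - h y v (J u) := by
  rw [H.symm y hy, H.inner_J_left hy]

theorem leeField_sharp_anti (H : LocalVaisman h θ J s) (hy : y ∈ s) :
    sharp (h y) ((θ y).comp J) = - J (leeField h θ y) :=
  (eq_sharp (H.pos y hy) fun v => by
    rw [map_neg, neg_apply, H.inner_J_lee hy, neg_neg]; rfl).symm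

theorem shape_lee (H : LocalVaisman h θ J s) (hy : y ∈ s) :
    antiLeeShape h θ J y (leeField h θ y) = 0 := by
  rw [antiLeeShape_apply, H.form_lee hy, H.form_J_lee hy]; module

theorem shape_J_lee (H : LocalVaisman h θ J s) (hy : y ∈ s) :
    antiLeeShape h θ J y (J (leeField h θ y)) = 0 := by
  rw [antiLeeShape_apply, H.J_sq, map_neg, H.form_lee hy, H.form_J_lee hy]; module

theorem form_shape (H : LocalVaisman h θ J s) (hy : y ∈ s) (u : E) :
    θ y (antiLeeShape h θ J y u) = 0 := by
  rw [antiLeeShape_apply]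
  simp only [map_smul, map_sub, H.form_lee hy, H.form_J_lee hy, smul_eq_mul]; ring

theorem form_J_shape (H : LocalVaisman h θ J s) (hy : y ∈ s) (u : E) :
    θ y (J (antiLeeShape h θ J y u)) = 0 := by
  rw [antiLeeShape_apply]
  simp only [map_smul, map_sub, map_neg, H.form_lee hy, H.form_J_lee hy, H.J_sq, smul_eq_mul]; ring

theorem shape_skew (H : LocalVaisman h θ J s) (hy : y ∈ s) (u v : E) :
    h y (antiLeeShape h θ J y u) v = - h y u (antiLeeShape h θ J y v) := by
  simp only [antiLeeShape_apply, map_smul, map_sub, smul_apply, sub_apply, H.inner_lee hy,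
    H.inner_lee' hy, H.inner_J_lee hy, H.inner_J_lee' hy, smul_eq_mul]
  rw [H.inner_J_left hy]
  ring

theorem shape_shape (H : LocalVaisman h θ J s) (hy : y ∈ s) {u : E} (hu : θ y u = 0)
    (hu' : θ y (J u) = 0) :
    antiLeeShape h θ J y (antiLeeShape h θ J y u) = -(1 / 4 : ℝ) • u := by
  rw [antiLeeShape_apply, H.form_shape hy, H.form_J_shape hy, antiLeeShape_apply, hu, hu']
  simp only [map_smul, map_sub, H.J_sq]
  module

end LocalVaisman

end Vaisman

/-! ### Covariant derivatives of J, U and F. -/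

section Vaisman

variable {E : Type*} [NormedAddCommGroup E] [NormedSpace ℝ E] [FiniteDimensional ℝ E]
variable {h : E → E →L[ℝ] E →L[ℝ] ℝ} {θ : E → E →L[ℝ] ℝ} {J : E →L[ℝ] E} {s : Set E} {y : E}

theorem contDiffAt_of_apply {F : Type*} [NormedAddCommGroup F] [NormedSpace ℝ F] {n : WithTop ℕ∞}
    {f : E → E →L[ℝ] F} (hf : ∀ v, ContDiffAt ℝ n (fun z => f z v) y) : ContDiffAt ℝ n f y := by
  let d := Module.finrank ℝ E
  have hd : d = Module.finrank ℝ (Fin d → ℝ) := (Module.finrank_fin_fun ℝ).symm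
  let e₁ := ContinuousLinearEquiv.ofFinrankEq hd
  let e₂ := (e₁.arrowCongr (1 : F ≃L[ℝ] F)).trans (ContinuousLinearEquiv.piRing (Fin d))
  rw [← Function.id_comp f, ← e₂.symm_comp_self]
  exact e₂.symm.contDiff.contDiffAt.comp y (contDiffAt_pi.mpr fun i => hf _)

theorem lineDeriv_congr {F : Type*} [NormedAddCommGroup F] [NormedSpace ℝ F] {f : E → F}
    {f' g' : F} {x u : E} (hf : HasLineDerivAt ℝ f f' x u) (hg : f' = g') :
    HasLineDerivAt ℝ f g' x u := hg ▸ hf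

theorem bilinPull_id_eq (B : E →L[ℝ] E →L[ℝ] ℝ) (J : E →L[ℝ] E) :
    bilinPull B (ContinuousLinearMap.id ℝ E) J
      = ((ContinuousLinearMap.compL ℝ E E ℝ).flip J).comp B := rfl

theorem fderiv_bilinPull_id (hh : DifferentiableAt ℝ h y) (J : E →L[ℝ] E) (u v w : E) :
    fderiv ℝ (fun z => bilinPull (h z) (ContinuousLinearMap.id ℝ E) J) y u v w
      = fderiv ℝ h y u v (J w) := by
  simp only [bilinPull_id_eq]
  have hd : DifferentiableAt ℝ (fun z => ((ContinuousLinearMap.compL ℝ E E ℝ).flip J).comp (h z)) y :=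
    (differentiableAt_const _).clm_comp hh
  have h1 := lineDeriv_clm_apply (lineDeriv_clm_apply (lineDeriv_of_differentiableAt hd u)
    (lineDeriv_const v y u)) (lineDeriv_const w y u)
  have h2 := lineDeriv_clm_apply (lineDeriv_clm_apply (lineDeriv_of_differentiableAt hh u)
    (lineDeriv_const v y u)) (lineDeriv_const (J w) y u)
  have h3 := lineDeriv_eq_of_eventuallyEq h1 h2 (Filter.Eventually.of_forall fun _ => rfl)
  simpa using h3

namespace LocalVaisman

theorem fderiv_J_left (H : LocalVaisman h θ J s) (hy : y ∈ s) (u v w : E) :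
    fderiv ℝ h y u (J v) w = - fderiv ℝ h y u v (J w) := by
  have h1 := lineDeriv_add (H.lineDeriv_apply hy u (J v) w) (H.lineDeriv_apply hy u v (J w))
  have h2 := lineDeriv_eq_of_eventuallyEq h1 (lineDeriv_const (0 : ℝ) y u) (by
    filter_upwards [H.isOpen.mem_nhds hy] with z hz
    rw [H.inner_J_left hz]; ring)
  linarith

/-- For an integrable Hermitian structure, 2h((∇_u J)v, w) is a combination of dω(u, Jv, Jw) and
dω(u, v, w), and dω = θ ∧ ω makes both algebraic. Integrability enters as the constancy of `J`. -/
theorem christoffel_J (H : LocalVaisman h θ J s) (hy : y ∈ s) (u v : E) :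
    christoffelMap h y u (J v) = J (christoffelMap h y u v) + covJ h θ J y u v := by
  refine H.eq_of_inner hy fun w => ?_
  have e1 := H.two_inner_christoffel hy u (J v) w
  have e2 := H.two_inner_christoffel hy u v (J w)
  have d1 := H.d_fundamental y hy u (J v) (J w)
  have d2 := H.d_fundamental y hy u v w
  simp only [dTwoForm, wedgeOneTwo, fderiv_bilinPull_id (H.differentiableAt hy)] at d1 d2
  simp only [bilinPull_id_eq,
    ContinuousLinearMap.comp_apply, ContinuousLinearMap.flip_apply,
    ContinuousLinearMap.compL_apply, H.J_sq, map_neg] at d1 d2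
  have f1 := H.fderiv_J_left hy u v w
  rw [H.inner_J_left hy v w] at d1
  simp only [covJ, map_add, map_sub, map_smul, add_apply, sub_apply, smul_apply, smul_eq_mul,
    H.inner_J_left hy (christoffelMap h y u v), H.inner_lee hy, H.inner_J_lee hy,
    H.inner_J_left hy u w]
  linarith

theorem contDiffAt_form (H : LocalVaisman h θ J s) (hy : y ∈ s) : ContDiffAt ℝ ∞ θ y :=
  H.smooth_form.contDiffAt (H.isOpen.mem_nhds hy)

theorem contDiffAt_lee (H : LocalVaisman h θ J s) (hy : y ∈ s) :
    ContDiffAt ℝ ∞ (leeField h θ) y :=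
  H.contDiffAt_sharp hy (H.contDiffAt_form hy)

theorem contDiffAt_shape (H : LocalVaisman h θ J s) (hy : y ∈ s) :
    ContDiffAt ℝ ∞ (antiLeeShape h θ J) y := by
  have h1 := H.contDiffAt_form hy
  have h2 := H.contDiffAt_lee hy
  refine contDiffAt_of_apply fun v => ?_
  simp only [antiLeeShape_apply]
  fun_prop

theorem contDiffAt_twist (H : LocalVaisman h θ J s) (hy : y ∈ s) :
    ContDiffAt ℝ ∞ (twist h θ J) y := by
  have h1 := H.contDiffAt_form hy
  have h2 := H.contDiffAt_lee hy
  have h3 := H.contDiffAt_shape hy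
  have h4 := H.contDiffAt hy
  refine contDiffAt_of_apply fun v => contDiffAt_of_apply fun w => ?_
  simp only [twist_apply]
  fun_prop

theorem lineDeriv_form (H : LocalVaisman h θ J s) (hy : y ∈ s) (u : E) :
    HasLineDerivAt ℝ θ (fderiv ℝ θ y u) y u :=
  lineDeriv_of_differentiableAt ((H.contDiffAt_form hy).differentiableAt (by simp)) u

theorem fderiv_form (H : LocalVaisman h θ J s) (hy : y ∈ s) (u v : E) :
    fderiv ℝ θ y u v = θ y (christoffelMap h y u v) := by
  rw [H.parallel y hy, christoffelMap_apply]

/-- This is ∇U = 0: the metric identification of vectors with covectors commutes with ∇, and ∇θ = 0.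
-/
theorem lineDeriv_lee (H : LocalVaisman h θ J s) (hy : y ∈ s) (u : E) :
    HasLineDerivAt ℝ (leeField h θ) (- christoffelMap h y u (leeField h θ y)) y u := by
  have hU := lineDeriv_of_differentiableAt ((H.contDiffAt_lee hy).differentiableAt (by simp)) u
  have hh := lineDeriv_of_differentiableAt (H.differentiableAt hy) u
  refine lineDeriv_congr hU (Eq.symm ?_)
  refine H.eq_of_inner hy fun w => ?_
  have e1 := lineDeriv_eq_of_eventuallyEq
    (lineDeriv_clm_apply (lineDeriv_clm_apply hh hU) (lineDeriv_const w y u))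
    (lineDeriv_clm_apply (H.lineDeriv_form hy u) (lineDeriv_const w y u))
    (by filter_upwards [H.isOpen.mem_nhds hy] with z hz using H.inner_lee hz w)
  simp only [map_zero, add_zero, H.fderiv_form hy, add_apply, H.fderiv_eq hy, H.inner_lee hy] at e1
  rw [map_neg, neg_apply]
  linarith

/-- Leibniz rule for F = (J - θ ⊗ JU - θᶜ ⊗ U)/2: as θ and U are parallel, only ∇J, ∇(JU) = -F and
∇θᶜ contribute, which are the three terms of `covShape`. -/
theorem lineDeriv_shape (H : LocalVaisman h θ J s) (hy : y ∈ s) (u v : E) :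
    HasLineDerivAt ℝ (fun z => antiLeeShape h θ J z v)
      (covShape h θ J y u v - christoffelMap h y u (antiLeeShape h θ J y v)
        + antiLeeShape h θ J y (christoffelMap h y u v)) y u := by
  have hθ := H.lineDeriv_form hy u
  have hU := H.lineDeriv_lee hy u
  have e1 := lineDeriv_clm ((1 / 2 : ℝ) • ContinuousLinearMap.id ℝ E) (lineDeriv_sub (lineDeriv_sub
    (lineDeriv_const (J v) y u)
    (lineDeriv_smul (lineDeriv_clm_apply hθ (lineDeriv_const v y u)) (lineDeriv_clm J hU)))
    (lineDeriv_smul (lineDeriv_clm_apply hθ (lineDeriv_const (J v) y u)) hU))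
  simp only [antiLeeShape_apply]
  refine lineDeriv_congr e1 (Eq.symm ?_)
  simp only [covShape, map_zero, add_zero, antiLeeShape_apply, H.fderiv_form hy, smul_apply,
    ContinuousLinearMap.id_apply, map_sub, map_smul, map_neg, map_add, H.christoffel_J hy, covJ,
    sub_apply, H.inner_lee hy, H.inner_J_lee hy, H.inner_J_left hy u, H.form_lee hy,
    H.form_J_lee hy, H.inner_J_lee' hy, H.inner_lee' hy, H.J_sq, smul_eq_mul]
  module

end LocalVaisman

end Vaisman

/-! ### Ricci tensor in the vertical directions. -/

section Vaisman

variable {E : Type*} [NormedAddCommGroup E] [NormedSpace ℝ E] [FiniteDimensional ℝ E]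
variable {h : E → E →L[ℝ] E →L[ℝ] ℝ} {θ : E → E →L[ℝ] ℝ} {J : E →L[ℝ] E} {s : Set E} {y : E}

theorem curvatureMap_eq_sub {B : E → E →L[ℝ] E →L[ℝ] E} {Z : E → E}
    (hB : DifferentiableAt ℝ B y) (hZ : ContDiffAt ℝ 2 Z y) (u v : E) :
    curvatureMap B y v (Z y) u = connDeriv B (fun _ => u) (connDeriv B (fun _ => v) Z) y
      - connDeriv B (fun _ => v) (connDeriv B (fun _ => u) Z) y := by
  rw [← curvature_const_eq hB hZ (fun _ _ => rfl) (by simp [connDeriv]), curvature]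
  simp [lieBracket, connDeriv]

theorem connDeriv_congr {B : E → E →L[ℝ] E →L[ℝ] E} {X Z Z' : E → E} (hZ : Z =ᶠ[nhds y] Z') :
    connDeriv B X Z y = connDeriv B X Z' y := by
  simp only [connDeriv, hZ.fderiv_eq, hZ.eq_of_nhds]

namespace LocalVaisman

theorem covJ_lee (H : LocalVaisman h θ J s) (hy : y ∈ s) (u : E) :
    covJ h θ J y u (leeField h θ y) = - antiLeeShape h θ J y u := by
  rw [covJ, antiLeeShape_apply, H.form_J_lee hy, H.form_lee hy, H.inner_J_lee' hy, H.inner_lee' hy]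
  module

/-- As θ is parallel, the left side is (∇_u θᶜ)(v); thus ∇θᶜ = h(F·,·). -/
theorem form_covJ (H : LocalVaisman h θ J s) (hy : y ∈ s) (u v : E) :
    θ y (covJ h θ J y u v) = h y (antiLeeShape h θ J y u) v := by
  simp only [covJ, antiLeeShape_apply, map_add, map_sub, map_smul, smul_apply, sub_apply,
    H.form_J_lee hy, H.form_lee hy, H.inner_J_lee hy, H.inner_lee hy, H.inner_J_left hy u,
    smul_eq_mul]
  ring

theorem christoffel_J_lee (H : LocalVaisman h θ J s) (hy : y ∈ s) (u : E) :
    christoffelMap h y u (J (leeField h θ y))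
      = J (christoffelMap h y u (leeField h θ y)) - antiLeeShape h θ J y u := by
  rw [H.christoffel_J hy, H.covJ_lee hy]; abel

theorem form_christoffel_J (H : LocalVaisman h θ J s) (hy : y ∈ s) (u v : E) :
    θ y (christoffelMap h y u (J v))
      = θ y (J (christoffelMap h y u v)) + h y (antiLeeShape h θ J y u) v := by
  rw [H.christoffel_J hy, map_add, H.form_covJ hy]

theorem curvature_lee (H : LocalVaisman h θ J s) (hy : y ∈ s) (u v : E) :
    curvatureMap (christoffelMap h) y v (leeField h θ y) u = 0 := by
  have key : ∀ v, connDeriv (christoffelMap h) (fun _ => v) (leeField h θ) =ᶠ[nhds y]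
      fun _ => 0 := fun v => by
    filter_upwards [H.isOpen.mem_nhds hy] with z hz
    rw [connDeriv, fderiv_apply_eq ((H.contDiffAt_lee hz).differentiableAt (by simp))
      (H.lineDeriv_lee hz v)]
    abel
  rw [curvatureMap_eq_sub (H.differentiableAt_christoffelMap hy)
    ((H.contDiffAt_lee hy).of_le ENat.LEInfty.out), connDeriv_congr (key v), connDeriv_congr (key u)]
  simp [connDeriv]

/-- Since ∇_v(JU) = -Fv, the curvature on JU is the antisymmetrisation of -∇F. The terms F(Γ(u, v))
drop out because Γ is symmetric. -/
theorem curvature_J_lee (H : LocalVaisman h θ J s) (hy : y ∈ s) (u v : E) :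
    curvatureMap (christoffelMap h) y v (J (leeField h θ y)) u
      = covShape h θ J y v u - covShape h θ J y u v := by
  have hJU : ∀ z ∈ s, ContDiffAt ℝ ∞ (fun z => J (leeField h θ z)) z := fun z hz => by
    have := H.contDiffAt_lee hz
    fun_prop
  have key : ∀ v, connDeriv (christoffelMap h) (fun _ => v) (fun z => J (leeField h θ z))
      =ᶠ[nhds y] fun z => (-1 : ℝ) • antiLeeShape h θ J z v := fun v => by
    filter_upwards [H.isOpen.mem_nhds hy] with z hz
    rw [connDeriv, fderiv_apply_eq ((hJU z hz).differentiableAt (by simp))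
      (lineDeriv_clm J (H.lineDeriv_lee hz v)), H.christoffel_J_lee hz, map_neg]
    module
  have key2 : ∀ u v, connDeriv (christoffelMap h) (fun _ => u)
      (fun z => (-1 : ℝ) • antiLeeShape h θ J z v) y
      = - covShape h θ J y u v - antiLeeShape h θ J y (christoffelMap h y u v) := fun u v => by
    have hs := H.contDiffAt_shape hy
    have hd : ContDiffAt ℝ ∞ (fun z => (-1 : ℝ) • antiLeeShape h θ J z v) y := by fun_prop
    rw [connDeriv, fderiv_apply_eq (hd.differentiableAt (by simp))
      (lineDeriv_clm ((-1 : ℝ) • ContinuousLinearMap.id ℝ E) (H.lineDeriv_shape hy u v))]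
    simp only [smul_apply, ContinuousLinearMap.id_apply, map_smul]
    module
  have h2 := curvatureMap_eq_sub (Z := fun z => J (leeField h θ z))
    (H.differentiableAt_christoffelMap hy) ((hJU y hy).of_le ENat.LEInfty.out) u v
  rw [connDeriv_congr (key v), connDeriv_congr (key u), key2, key2, H.christoffel_symm hy v u] at h2
  rw [h2]
  abel

theorem opTrace_J (H : LocalVaisman h θ J s) (hy : y ∈ s) : opTrace J = 0 :=
  opTrace_skew (H.pos y hy) J (H.inner_J_left hy)

theorem opTrace_shape (H : LocalVaisman h θ J s) (hy : y ∈ s) :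
    opTrace (antiLeeShape h θ J y) = 0 :=
  opTrace_skew (H.pos y hy) _ (H.shape_skew hy)

theorem opTrace_smul_id (c : ℝ) : opTrace (fun u : E => c • u) = c * Module.finrank ℝ E := by
  rw [opTrace_smul, opTrace_id]

theorem opTrace_covShape (H : LocalVaisman h θ J s) (hy : y ∈ s) (v : E) :
    opTrace (fun u => covShape h θ J y u v) = ((Module.finrank ℝ E : ℝ) - 2) / 4 * θ y (J v) := by
  simp only [covShape, covJ, opTrace_smul_id, opTrace_smul, opTrace_add, opTrace_sub]
  have e1 : opTrace (fun u => h y u (J v) • leeField h θ y) = _ :=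
    opTrace_rankOne ((h y).flip (J v)) _
  have e2 : opTrace (fun u => h y u v • J (leeField h θ y)) = _ :=
    opTrace_rankOne ((h y).flip v) _
  have e3 : opTrace (fun u => h y (antiLeeShape h θ J y u) v • leeField h θ y) = _ :=
    opTrace_rankOne (((h y).flip v).comp (antiLeeShape h θ J y)) _
  rw [e1, e2, e3, H.opTrace_J hy, H.opTrace_shape hy]
  simp only [ContinuousLinearMap.flip_apply, ContinuousLinearMap.comp_apply, H.inner_lee hy,
    H.inner_J_lee hy, H.shape_lee hy, map_zero, zero_apply]
  ring

theorem opTrace_covShape' (H : LocalVaisman h θ J s) (hy : y ∈ s) (v : E) :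
    opTrace (fun u => covShape h θ J y v u) = 0 := by
  simp only [covShape, covJ, opTrace_smul, opTrace_add, opTrace_sub, opTrace_id]
  have e1 : opTrace (fun u => θ y (J u) • v) = _ := opTrace_rankOne ((θ y).comp J) _
  have e2 : opTrace (fun u => h y v (J u) • leeField h θ y) = _ :=
    opTrace_rankOne ((h y v).comp J) _
  rw [e1, e2]
  simp only [opTrace_rankOne, ContinuousLinearMap.comp_apply, H.form_shape hy, H.inner_lee' hy]
  ring

theorem ricciForm_lee (H : LocalVaisman h θ J s) (hy : y ∈ s) (v : E) :
    ricciForm (christoffelMap h) y v (leeField h θ y) = 0 := by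
  rw [ricciForm]
  exact (congrArg opTrace (funext fun u => H.curvature_lee hy u v)).trans opTrace_zero

/-- Only the divergence of F contributes; the trace of ∇F over its other slot vanishes. In real
dimension 2n + 2 the factor is n/2. -/
theorem ricciForm_J_lee (H : LocalVaisman h θ J s) (hy : y ∈ s) (v : E) :
    ricciForm (christoffelMap h) y v (J (leeField h θ y))
      = - (((Module.finrank ℝ E : ℝ) - 2) / 4 * θ y (J v)) := by
  rw [ricciForm]
  refine (congrArg opTrace (funext fun u => H.curvature_J_lee hy u v)).trans ?_
  rw [opTrace_sub, H.opTrace_covShape hy, H.opTrace_covShape' hy, zero_sub]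

end LocalVaisman

end Vaisman

/-! ### Ricci contraction of the adapted connection ∇ + A. -/

section Vaisman

variable {E : Type*} [NormedAddCommGroup E] [NormedSpace ℝ E] [FiniteDimensional ℝ E]
variable {h : E → E →L[ℝ] E →L[ℝ] ℝ} {θ : E → E →L[ℝ] ℝ} {J : E →L[ℝ] E} {s : Set E} {y : E}

/-- The covariant derivative `(∇_u A)(v, w)` of `A = twist`. -/
def covTwist (h : E → E →L[ℝ] E →L[ℝ] ℝ) (θ : E → E →L[ℝ] ℝ) (J : E →L[ℝ] E) (y u v w : E) : E :=
  -h y (covShape h θ J y u v) w • J (leeField h θ y)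
    + h y (antiLeeShape h θ J y v) w • antiLeeShape h θ J y u
    - h y (antiLeeShape h θ J y u) v • antiLeeShape h θ J y w
    - θ y (J v) • covShape h θ J y u w
    - h y (antiLeeShape h θ J y u) w • antiLeeShape h θ J y v
    - θ y (J w) • covShape h θ J y u v

theorem antiLeeShape_of_horizontal {v : E} (hv : θ y v = 0)
    (hv' : θ y (J v) = 0) : antiLeeShape h θ J y v = (1 / 2 : ℝ) • J v := by
  rw [antiLeeShape_apply, hv, hv']; module

namespace LocalVaisman

theorem fderiv_twist (H : LocalVaisman h θ J s) (hy : y ∈ s) (u v w : E) :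
    fderiv ℝ (twist h θ J) y u v w = covTwist h θ J y u v w
      - christoffelMap h y u (twist h θ J y v w) + twist h θ J y (christoffelMap h y u v) w
      + twist h θ J y v (christoffelMap h y u w) := by
  have hA := lineDeriv_of_differentiableAt ((H.contDiffAt_twist hy).differentiableAt (by simp)) u
  have e1 := lineDeriv_clm_apply (lineDeriv_clm_apply hA (lineDeriv_const v y u))
    (lineDeriv_const w y u)
  have hh := lineDeriv_of_differentiableAt (H.differentiableAt hy) u
  have hθ := H.lineDeriv_form hy u
  have hU := H.lineDeriv_lee hy u
  have e2 := lineDeriv_sub (lineDeriv_sub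
    (lineDeriv_smul (lineDeriv_clm ((-1 : ℝ) • ContinuousLinearMap.id ℝ ℝ)
        (lineDeriv_clm_apply (lineDeriv_clm_apply hh (H.lineDeriv_shape hy u v))
          (lineDeriv_const w y u)))
      (lineDeriv_clm J hU))
    (lineDeriv_smul (lineDeriv_clm_apply hθ (lineDeriv_const (J v) y u))
      (H.lineDeriv_shape hy u w)))
    (lineDeriv_smul (lineDeriv_clm_apply hθ (lineDeriv_const (J w) y u))
      (H.lineDeriv_shape hy u v))
  have e3 := lineDeriv_eq_of_eventuallyEq e1 e2 (Filter.Eventually.of_forall fun z => by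
    simp [twist_apply])
  simp only [map_zero, add_zero, zero_add] at e3
  rw [e3]
  simp only [covTwist, twist_apply, map_add, map_sub, map_smul, map_neg, add_apply, sub_apply,
    neg_apply, smul_apply, ContinuousLinearMap.id_apply, H.fderiv_eq hy, H.fderiv_form hy,
    H.form_christoffel_J hy, H.christoffel_J_lee hy, smul_eq_mul]
  module

theorem inner_covShape (H : LocalVaisman h θ J s) (hy : y ∈ s) {v w : E} (hv : θ y v = 0)
    (hv' : θ y (J v) = 0) (hw : θ y w = 0) (hw' : θ y (J w) = 0) (u : E) :
    h y (covShape h θ J y u v) w = 0 := by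
  simp only [covShape, covJ, map_smul, map_add, map_sub, smul_apply, add_apply, sub_apply,
    H.inner_lee hy, H.inner_J_lee hy, hv, hv', hw, hw', smul_eq_mul]
  ring

theorem inner_shape_shape (H : LocalVaisman h θ J s) (hy : y ∈ s) {v : E} (hv : θ y v = 0)
    (hv' : θ y (J v) = 0) (w : E) :
    h y (antiLeeShape h θ J y v) (antiLeeShape h θ J y w) = 1 / 4 * h y v w := by
  have h1 := H.shape_skew hy (antiLeeShape h θ J y v) w
  rw [H.shape_shape hy hv hv'] at h1
  simp only [map_smul, smul_apply, smul_eq_mul] at h1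
  linarith

theorem inner_covShape' (H : LocalVaisman h θ J s) (hy : y ∈ s) {v w : E} (hv : θ y v = 0)
    (hv' : θ y (J v) = 0) (hw : θ y w = 0) (hw' : θ y (J w) = 0) (u : E) :
    h y (covShape h θ J y v u) w = 1 / 4 * h y v w * θ y (J u) := by
  simp only [covShape, covJ, antiLeeShape_of_horizontal hv hv', map_smul, map_add, map_sub, smul_apply, add_apply,
    sub_apply, H.inner_lee hy, H.inner_J_lee hy, hv, hv', hw, hw', smul_eq_mul]
  ring

theorem form_J_covShape (H : LocalVaisman h θ J s) (hy : y ∈ s) {v w : E} (hv : θ y v = 0)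
    (hv' : θ y (J v) = 0) (hw : θ y w = 0) (hw' : θ y (J w) = 0) :
    θ y (J (covShape h θ J y v w)) = - (1 / 4) * h y v w := by
  simp only [covShape, covJ, antiLeeShape_of_horizontal hv hv', map_smul, map_add, map_sub, smul_apply, add_apply,
    sub_apply, H.J_sq, map_neg, H.form_lee hy, H.form_J_lee hy, hv, hv', hw, hw', smul_eq_mul]
  ring

/-- Source of the 1/2 in Ricᵀ = Ric + g/2: on Q the map F is half an isometry, so h(Fv, Fw) = h(v,
w)/4, and this term occurs twice. -/
theorem opTrace_covTwist (H : LocalVaisman h θ J s) (hy : y ∈ s) {v w : E} (hv : θ y v = 0)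
    (hv' : θ y (J v) = 0) (hw : θ y w = 0) (hw' : θ y (J w) = 0) :
    opTrace (fun u => covTwist h θ J y u v w) = 1 / 2 * h y v w := by
  have e0 : (fun u => covTwist h θ J y u v w) = fun u =>
      h y (antiLeeShape h θ J y v) w • antiLeeShape h θ J y u
      + h y (antiLeeShape h θ J y v) u • antiLeeShape h θ J y w
      + h y (antiLeeShape h θ J y w) u • antiLeeShape h θ J y v := by
    funext u
    rw [covTwist, H.inner_covShape hy hv hv' hw hw', hv', hw', H.shape_skew hy u v,
      H.shape_skew hy u w, H.symm y hy u, H.symm y hy u]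
    module
  rw [e0]
  simp only [opTrace_add, opTrace_smul, opTrace_rankOne, H.opTrace_shape hy,
    H.inner_shape_shape hy hv hv', H.inner_shape_shape hy hw hw']
  rw [H.symm y hy w v]
  ring

/-- The rank-one term along θ ∘ J contributes h(v, w)/2, and the two terms with h(Fv, Fw) take it
away again. -/
theorem opTrace_covTwist' (H : LocalVaisman h θ J s) (hy : y ∈ s) {v w : E} (hv : θ y v = 0)
    (hv' : θ y (J v) = 0) (hw : θ y w = 0) (hw' : θ y (J w) = 0) :
    opTrace (fun u => covTwist h θ J y v u w) = 0 := by
  have e0 : (fun u => covTwist h θ J y v u w) = fun u =>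
      θ y (J u) • (-(1 / 4 * h y v w) • J (leeField h θ y) - covShape h θ J y v w)
      - h y (antiLeeShape h θ J y w) u • antiLeeShape h θ J y v
      - h y (antiLeeShape h θ J y v) u • antiLeeShape h θ J y w
      - h y (antiLeeShape h θ J y v) w • antiLeeShape h θ J y u := by
    funext u
    rw [covTwist, H.inner_covShape' hy hv hv' hw hw', hw', H.shape_skew hy u w, H.symm y hy u]
    module
  have e1 : ∀ z, opTrace (fun u => θ y (J u) • z) = θ y (J z) := opTrace_rankOne ((θ y).comp J)
  rw [e0]
  simp only [opTrace_sub, opTrace_smul, opTrace_rankOne, e1, H.opTrace_shape hy,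
    H.inner_shape_shape hy hv hv', H.inner_shape_shape hy hw hw', map_sub, map_smul, H.J_sq,
    map_neg, H.form_lee hy, H.form_J_covShape hy hv hv' hw hw', smul_eq_mul]
  rw [H.symm y hy w v]
  ring

/-- With ∇_u(JU) = -Fu this says that JU is parallel for ∇ + A. -/
theorem twist_J_lee (H : LocalVaisman h θ J s) (hy : y ∈ s) (u : E) :
    twist h θ J y u (J (leeField h θ y)) = antiLeeShape h θ J y u := by
  rw [twist_apply, H.shape_J_lee hy, H.J_sq, map_neg, H.form_lee hy, H.inner_J_lee' hy,
    H.form_J_shape hy]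
  module

theorem opTrace_twist_twist (H : LocalVaisman h θ J s) (hy : y ∈ s) {v w : E}
    (hv' : θ y (J v) = 0) (hw' : θ y (J w) = 0) :
    opTrace (fun u => twist h θ J y u (twist h θ J y v w)) = 0 := by
  have e0 : (fun u => twist h θ J y u (twist h θ J y v w)) = fun u =>
      -h y (antiLeeShape h θ J y v) w • antiLeeShape h θ J y u := by
    funext u
    rw [twist_apply y v w, hv', hw']
    simp only [zero_smul, sub_zero, map_smul, H.twist_J_lee hy]
  rw [e0, opTrace_smul, H.opTrace_shape hy, mul_zero]

theorem opTrace_twist_twist' (H : LocalVaisman h θ J s) (hy : y ∈ s) {v w : E}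
    (hv' : θ y (J v) = 0) (hw' : θ y (J w) = 0) :
    opTrace (fun u => twist h θ J y v (twist h θ J y u w)) = 0 := by
  have e0 : (fun u => twist h θ J y v (twist h θ J y u w)) = fun u =>
      h y (antiLeeShape h θ J y w) u • antiLeeShape h θ J y v
      + θ y (J u) • (h y (antiLeeShape h θ J y v) (antiLeeShape h θ J y w)
          • J (leeField h θ y)) := by
    funext u
    rw [twist_apply y u w, hw', H.shape_skew hy u w, H.symm y hy u]
    simp only [zero_smul, sub_zero, map_sub, map_smul, H.twist_J_lee hy, neg_neg]
    rw [twist_apply y v (antiLeeShape h θ J y w), hv', H.form_J_shape hy]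
    module
  have e1 : ∀ z, opTrace (fun u => θ y (J u) • z) = θ y (J z) := opTrace_rankOne ((θ y).comp J)
  rw [e0]
  simp only [opTrace_add, opTrace_rankOne, e1, map_smul, H.J_sq, map_neg, H.form_lee hy,
    smul_eq_mul]
  rw [H.symm y hy (antiLeeShape h θ J y v)]
  ring

/-- The connection preserving the canonical foliation and its complement. -/
def _root_.VaismanGeometry.adaptedMap (h : E → E →L[ℝ] E →L[ℝ] ℝ) (θ : E → E →L[ℝ] ℝ)
    (J : E →L[ℝ] E) (y : E) : E →L[ℝ] E →L[ℝ] E := christoffelMap h y + twist h θ J y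

theorem contDiffAt_adaptedMap (H : LocalVaisman h θ J s) (hy : y ∈ s) :
    ContDiffAt ℝ ∞ (adaptedMap h θ J) y :=
  (H.contDiffAt_christoffelMap hy).add (H.contDiffAt_twist hy)

/-- Of the four traces produced by `curvatureMap_add`, only that of ∇A over its differentiation slot
is nonzero. -/
theorem ricciForm_adaptedMap (H : LocalVaisman h θ J s) (hy : y ∈ s) {v w : E} (hv : θ y v = 0)
    (hv' : θ y (J v) = 0) (hw : θ y w = 0) (hw' : θ y (J w) = 0) :
    ricciForm (adaptedMap h θ J) y v w
      = ricciForm (christoffelMap h) y v w + 1 / 2 * h y v w := by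
  have e0 : (curvatureMap (adaptedMap h θ J) y v w : E → E) = fun u =>
      curvatureMap (christoffelMap h) y v w u + covTwist h θ J y u v w - covTwist h θ J y v u w
      + (twist h θ J y u (twist h θ J y v w) - twist h θ J y v (twist h θ J y u w)) := by
    funext u
    refine (curvatureMap_add (H.differentiableAt_christoffelMap hy)
      ((H.contDiffAt_twist hy).differentiableAt (by simp)) (H.christoffel_symm hy) u v w).trans ?_
    rw [H.fderiv_twist hy, H.fderiv_twist hy]
    abel
  rw [ricciForm, e0]
  simp only [opTrace_add, opTrace_sub, H.opTrace_covTwist hy hv hv' hw hw',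
    H.opTrace_covTwist' hy hv hv' hw hw', H.opTrace_twist_twist hy hv' hw',
    H.opTrace_twist_twist' hy hv' hw']
  rw [ricciForm]
  ring

end LocalVaisman

end Vaisman

/-! ### Bott connections as restrictions of connections d + B. -/

section Vaisman

variable {E : Type*} [NormedAddCommGroup E] [NormedSpace ℝ E] [FiniteDimensional ℝ E]
variable {h : E → E →L[ℝ] E →L[ℝ] ℝ} {θ : E → E →L[ℝ] ℝ} {J : E →L[ℝ] E} {s : Set E} {y : E}

theorem bott_congr (P : E → E → E) (X : E → E) {Z Z' : E → E} (hZ : Z =ᶠ[nhds y] Z') :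
    bott h P X Z y = bott h P X Z' y := by
  simp only [bott, leviCivita, lieBracket, hZ.fderiv_eq, hZ.eq_of_nhds]

theorem contDiffAt_connDeriv {B : E → E →L[ℝ] E →L[ℝ] E} {Z : E → E} (hB : ContDiffAt ℝ ∞ B y)
    (hZ : ContDiffAt ℝ ∞ Z y) (v : E) : ContDiffAt ℝ ∞ (connDeriv B (fun _ => v) Z) y := by
  have h1 : ContDiffAt ℝ ∞ (fderiv ℝ Z) y := hZ.fderiv_right (by simp)
  unfold connDeriv
  fun_prop

/-- If the Bott connection is the restriction of a connection `d + B` to sections of a subbundle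
preserved by `d + B`, then the transverse Ricci tensor is the Ricci contraction of `d + B`. -/
theorem transverseRicciLocal_eq {P : E → E → E} {B : E → E →L[ℝ] E →L[ℝ] E} {K : E → E → Prop}
    (hs : IsOpen s) (hy : y ∈ s) (hB : ∀ z ∈ s, ContDiffAt ℝ ∞ B z)
    (hP : ∀ z ∈ s, ∀ w, ContDiffAt ℝ ∞ (fun z => P z w) z)
    (hPK : ∀ z ∈ s, ∀ w, K z (P z w)) (hKP : ∀ z ∈ s, ∀ w, K z w → P z w = w)
    (hlin : IsLinearMap ℝ (P y))
    (hconn : ∀ Z : E → E, (∀ z ∈ s, ContDiffAt ℝ ∞ Z z) → (∀ z ∈ s, K z (Z z)) →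
      ∀ v, ∀ z ∈ s, K z (connDeriv B (fun _ => v) Z z))
    (hbott : ∀ Z : E → E, (∀ z ∈ s, ContDiffAt ℝ ∞ Z z) → (∀ z ∈ s, K z (Z z)) →
      ∀ v, ∀ z ∈ s, bott h P (fun _ => v) Z z = connDeriv B (fun _ => v) Z z)
    (v : E) {w : E} (hw : K y w) :
    transverseRicciLocal h P y v w = ricciForm B y v w := by
  set Z : E → E := fun z => P z w with hZ
  have hZs : ∀ z ∈ s, ContDiffAt ℝ ∞ Z z := fun z hz => hP z hz w
  have hZK : ∀ z ∈ s, K z (Z z) := fun z hz => hPK z hz w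
  have hZy : Z y = w := hKP y hy w hw
  have hDs : ∀ v, ∀ z ∈ s, ContDiffAt ℝ ∞ (connDeriv B (fun _ => v) Z) z := fun v z hz =>
    contDiffAt_connDeriv (hB z hz) (hZs z hz) v
  have hDK := hconn Z hZs hZK
  have hcurv : ∀ u v, curvature (bott h P) (fun _ => u) (fun _ => v) Z y
      = curvatureMap B y v w u := fun u v => by
    rw [← hZy]
    refine curvature_const_eq ((hB y hy).differentiableAt (by simp))
      ((hZs y hy).of_le ENat.LEInfty.out) (fun a b => ?_) ?_ u v
    -- The inner derivative has to be replaced on a neighbourhood, since it is differentiated again.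
    · rw [bott_congr P _ (Z' := connDeriv B (fun _ => b) Z)
        (by filter_upwards [hs.mem_nhds hy] with z hz using hbott Z hZs hZK b z hz),
        hbott _ (hDs b) (hDK b) a y hy]
    · rw [hbott Z hZs hZK 0 y hy]
      simp [connDeriv]
  -- Iterated derivatives of a section stay in the subbundle, hence so does the curvature, being
  -- their difference.
  have hRK : ∀ u, P y (curvatureMap B y v w u) = curvatureMap B y v w u := fun u => by
    have h1 := curvatureMap_eq_sub ((hB y hy).differentiableAt (by simp))
      ((hZs y hy).of_le ENat.LEInfty.out) u v
    have h2 := hlin.map_sub (connDeriv B (fun _ => u) (connDeriv B (fun _ => v) Z) y)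
      (connDeriv B (fun _ => v) (connDeriv B (fun _ => u) Z) y)
    rw [hKP y hy _ (hconn _ (hDs v) (hDK v) u y hy), hKP y hy _ (hconn _ (hDs u) (hDK u) v y hy),
      ← h1, hZy] at h2
    exact h2
  -- Cyclicity of the trace moves `P` from the argument of the curvature to its value, where it acts
  -- trivially.
  have h1 := opTrace_comp_comm (curvatureMap B y v w).toLinearMap (hlin.mk' _)
  have h2 : opTrace (fun u => P y (curvatureMap B y v w u)) = ricciForm B y v w := by
    rw [ricciForm]
    exact congrArg opTrace (funext hRK)
  rw [← h2]
  refine Eq.trans ?_ h1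
  exact Finset.sum_congr rfl fun i _ => by rw [hcurv]; rfl

namespace LocalVaisman

theorem lineDeriv_field {Z : E → E} (hZ : ContDiffAt ℝ ∞ Z y) (v : E) :
    HasLineDerivAt ℝ Z (fderiv ℝ Z y v) y v :=
  lineDeriv_of_differentiableAt (hZ.differentiableAt (by simp)) v

/-- Differentiating θ(Z) = 0 with θ parallel shows that ∇ preserves ker θ. -/
theorem form_connDeriv (H : LocalVaisman h θ J s) (hy : y ∈ s) {Z : E → E}
    (hZ : ContDiffAt ℝ ∞ Z y) (hK : ∀ z ∈ s, θ z (Z z) = 0) (v : E) :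
    θ y (fderiv ℝ Z y v + christoffelMap h y v (Z y)) = 0 := by
  have e1 := lineDeriv_eq_of_eventuallyEq
    (lineDeriv_clm_apply (H.lineDeriv_form hy v) (lineDeriv_field hZ v)) (lineDeriv_const 0 y v)
    (by filter_upwards [H.isOpen.mem_nhds hy] with z hz using hK z hz)
  rw [H.fderiv_form hy] at e1
  rw [map_add]
  linarith

/-- In contrast ∇ does not preserve ker θᶜ: the defect is ∇θᶜ = h(F·,·), which the first term of
`twist` compensates. -/
theorem form_J_connDeriv (H : LocalVaisman h θ J s) (hy : y ∈ s) {Z : E → E}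
    (hZ : ContDiffAt ℝ ∞ Z y) (hK : ∀ z ∈ s, θ z (J (Z z)) = 0) (v : E) :
    θ y (J (fderiv ℝ Z y v + christoffelMap h y v (Z y)))
      = - h y (antiLeeShape h θ J y v) (Z y) := by
  have e1 := lineDeriv_eq_of_eventuallyEq
    (lineDeriv_clm_apply (H.lineDeriv_form hy v) (lineDeriv_clm J (lineDeriv_field hZ v)))
    (lineDeriv_const 0 y v)
    (by filter_upwards [H.isOpen.mem_nhds hy] with z hz using hK z hz)
  rw [H.fderiv_form hy, H.form_christoffel_J hy] at e1
  rw [map_add, map_add]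
  linarith

theorem projLine_eq (z v : E) : projLine h θ z v = v - θ z v • leeField h θ z := rfl

theorem projPlane_eq (H : LocalVaisman h θ J s) (hy : y ∈ s) {β : E → E →L[ℝ] ℝ}
    (hβ : β y = (θ y).comp J) (v : E) : projPlane h θ β y v
      = v - θ y v • leeField h θ y + θ y (J v) • J (leeField h θ y) := by
  rw [projPlane, hβ, H.leeField_sharp_anti hy, leeField, ContinuousLinearMap.comp_apply]
  module

/-- Along the leaves [U, Z] = ∇_U Z - ∇_Z U = ∇_U Z since U is parallel, and ∇ preserves ker θ. The
Bott connection is thus ∇ itself, with no correction term. -/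
theorem transverseRicci_line (H : LocalVaisman h θ J s) (hy : y ∈ s) (v : E) {w : E}
    (hw : θ y w = 0) :
    transverseRicciLocal h (projLine h θ) y v w = ricciForm (christoffelMap h) y v w := by
  refine transverseRicciLocal_eq (K := fun z w => θ z w = 0) H.isOpen hy
    (fun z hz => H.contDiffAt_christoffelMap hz) (fun z hz w => ?_) (fun z hz w => ?_)
    (fun z hz w hw => ?_) ⟨fun a b => ?_, fun c a => ?_⟩ (fun Z hZ hK v z hz => ?_)
    (fun Z hZ hK v z hz => ?_) v hw
  · have h1 := H.contDiffAt_form hz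
    have h2 := H.contDiffAt_lee hz
    simp only [projLine_eq]
    fun_prop
  · simp only [projLine_eq, map_sub, map_smul, H.form_lee hz, smul_eq_mul]
    ring
  · rw [projLine_eq, hw]; module
  · simp only [projLine_eq, map_add]; module
  · simp only [projLine_eq, map_smul, smul_eq_mul]; module
  · exact H.form_connDeriv hz (hZ z hz) hK v
  · have hU := H.lineDeriv_lee hz (Z z)
    have hθ := H.lineDeriv_form hz (Z z)
    have hc : ContDiffAt ℝ ∞ (fun z => v - projLine h θ z v) z := by
      have h1 := H.contDiffAt_form hz
      have h2 := H.contDiffAt_lee hz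
      simp only [projLine_eq]
      fun_prop
    have e1 := fderiv_apply_eq (hc.differentiableAt (by simp)) (lineDeriv_congr
      ((lineDeriv_smul (lineDeriv_clm_apply hθ (lineDeriv_const v z (Z z))) hU).congr_of_eventuallyEq
        (Filter.Eventually.of_forall fun z => by simp [projLine_eq])) rfl)
    have e2 := H.form_connDeriv hz (hZ z hz) hK v
    have e3 : θ z (fderiv ℝ Z z v) = - θ z (christoffelMap h z v (Z z)) := by
      rw [map_add] at e2; linarith
    simp only [bott, leviCivita, lieBracket, e1, ← christoffelMap_apply, connDeriv]
    simp only [projLine_eq, map_add, map_sub, map_smul, map_neg, map_zero, add_zero, sub_apply,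
      smul_apply, H.form_lee hz, smul_eq_mul, H.christoffel_symm hz (leeField h θ z) (Z z), e3]
    module

/-- For a section Z of Q, the term -h(Fu, Z) JU of `twist` removes the part of ∇_u Z outside Q. The
term -θ(Ju) FZ turns ∇ into the bracket when u is along JU, because ∇_Z(JU) = -FZ. The third term
vanishes on Q. The formula for `P` is asked on `s` only, since the coordinate form of θᶜ is known to
be θ ∘ J only on the chart target. -/
theorem transverseRicci_plane (H : LocalVaisman h θ J s) (hy : y ∈ s) {P : E → E → E}
    (hP : ∀ z ∈ s, ∀ v, P z v = v - θ z v • leeField h θ z + θ z (J v) • J (leeField h θ z))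
    (v : E) {w : E} (hw : θ y w = 0) (hw' : θ y (J w) = 0) :
    transverseRicciLocal h P y v w
      = ricciForm (adaptedMap h θ J) y v w := by
  have hPs : ∀ z ∈ s, ∀ w, ContDiffAt ℝ ∞
      (fun z => w - θ z w • leeField h θ z + θ z (J w) • J (leeField h θ z)) z := fun z hz w => by
    have h1 := H.contDiffAt_form hz
    have h2 := H.contDiffAt_lee hz
    fun_prop
  refine transverseRicciLocal_eq (K := fun z w => θ z w = 0 ∧ θ z (J w) = 0) H.isOpen hy
    (fun z hz => H.contDiffAt_adaptedMap hz) (fun z hz w => ?_) (fun z hz w => ?_)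
    (fun z hz w hw => ?_) ⟨fun a b => ?_, fun c a => ?_⟩ (fun Z hZ hK v z hz => ?_)
    (fun Z hZ hK v z hz => ?_) v ⟨hw, hw'⟩
  · refine (hPs z hz w).congr_of_eventuallyEq ?_
    filter_upwards [H.isOpen.mem_nhds hz] with q hq using hP q hq w
  · rw [hP z hz]
    simp only [map_add, map_sub, map_smul, map_neg, H.J_sq, H.form_lee hz, H.form_J_lee hz,
      smul_eq_mul]
    constructor <;> ring
  · rw [hP z hz, hw.1, hw.2]; module
  · simp only [hP y hy, map_add]; module
  · simp only [hP y hy, map_smul, smul_eq_mul]; module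
  · have e1 := H.form_connDeriv hz (hZ z hz) (fun q hq => (hK q hq).1) v
    have e2 := H.form_J_connDeriv hz (hZ z hz) (fun q hq => (hK q hq).2) v
    simp only [connDeriv, adaptedMap, add_apply, twist_apply, ← add_assoc]
    rw [map_add (θ z), e1, map_add J, map_add (θ z), e2]
    simp only [map_sub, map_smul, map_neg, H.J_sq, H.form_lee hz, H.form_J_lee hz,
      H.form_shape hz, H.form_J_shape hz, smul_eq_mul]
    constructor <;> ring
  · have hU := H.lineDeriv_lee hz (Z z)
    have hθ := H.lineDeriv_form hz (Z z)
    have hc : ContDiffAt ℝ ∞ (fun z => v - (v - θ z v • leeField h θ z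
        + θ z (J v) • J (leeField h θ z))) z := contDiffAt_const.sub (hPs z hz v)
    have hE : (fun q => v - P q v) =ᶠ[nhds z]
        fun q => v - (v - θ q v • leeField h θ q + θ q (J v) • J (leeField h θ q)) := by
      filter_upwards [H.isOpen.mem_nhds hz] with q hq
      rw [hP q hq]
    have e1 := fderiv_apply_eq (hc.differentiableAt (by simp)) (lineDeriv_congr
      (lineDeriv_sub (lineDeriv_const v z (Z z)) (lineDeriv_add (lineDeriv_sub
        (lineDeriv_const v z (Z z))
        (lineDeriv_smul (lineDeriv_clm_apply hθ (lineDeriv_const v z (Z z))) hU))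
        (lineDeriv_smul (lineDeriv_clm_apply hθ (lineDeriv_const (J v) z (Z z)))
          (lineDeriv_clm J hU)))) rfl)
    have e2 := H.form_connDeriv hz (hZ z hz) (fun q hq => (hK q hq).1) v
    have e3 := H.form_J_connDeriv hz (hZ z hz) (fun q hq => (hK q hq).2) v
    have e4 : θ z (fderiv ℝ Z z v) = - θ z (christoffelMap h z v (Z z)) := by
      rw [map_add] at e2; linarith
    have e5 : θ z (J (fderiv ℝ Z z v)) = - θ z (J (christoffelMap h z v (Z z)))
        - h z (antiLeeShape h θ J z v) (Z z) := by
      rw [map_add, map_add] at e3; linarith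
    simp only [bott, leviCivita, lieBracket, hE.fderiv_eq, e1, ← christoffelMap_apply, connDeriv,
      adaptedMap, add_apply, twist_apply, (hK z hz).2]
    simp only [hP z hz, map_add, map_sub, map_smul, map_neg, map_zero, add_zero,
      sub_apply, add_apply, smul_apply, H.form_lee hz, H.form_J_lee hz, H.J_sq, smul_eq_mul,
      H.christoffel_symm hz (leeField h θ z) (Z z), H.christoffel_symm hz (J (leeField h θ z)) (Z z),
      H.christoffel_J_lee hz, H.form_shape hz, H.form_J_shape hz, H.fderiv_form hz, e4, e5]
    module

end LocalVaisman

end Vaisman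

/-! ### The Q-homothetic deformation in coordinates. -/

section Vaisman

variable {E : Type*} [NormedAddCommGroup E] [NormedSpace ℝ E] [FiniteDimensional ℝ E]
variable {h : E → E →L[ℝ] E →L[ℝ] ℝ} {θ : E → E →L[ℝ] ℝ} {J : E →L[ℝ] E} {s : Set E} {y : E}

/-- The bilinear form `a B + (a² - a)(αᶜ ⊗ αᶜ + α ⊗ α)` with `αᶜ = α ∘ J`. -/
def deform (a : ℝ) (B : E →L[ℝ] E →L[ℝ] ℝ) (α : E →L[ℝ] ℝ) (J : E →L[ℝ] E) :
    E →L[ℝ] E →L[ℝ] ℝ :=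
  a • B + (a ^ 2 - a) • ((α.comp J).smulRight (α.comp J) + α.smulRight α)

theorem deform_apply (a : ℝ) (B : E →L[ℝ] E →L[ℝ] ℝ) (α : E →L[ℝ] ℝ) (J : E →L[ℝ] E) (u v : E) :
    deform a B α J u v = a * B u v + (a ^ 2 - a) * (α (J u) * α (J v) + α u * α v) := by
  simp [deform, mul_add]

namespace LocalVaisman

theorem inner_shape (H : LocalVaisman h θ J s) (hy : y ∈ s) (u v : E) :
    h y (antiLeeShape h θ J y u) v
      = 1 / 2 * (θ y u * θ y (J v) - θ y (J u) * θ y v - h y u (J v)) := by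
  simp only [antiLeeShape_apply, map_smul, map_sub, smul_apply, sub_apply, H.inner_lee hy,
    H.inner_J_lee hy, H.inner_J_left hy u, smul_eq_mul]
  ring

/-- Bessel's inequality for the orthonormal pair U, JU: the difference of the two sides is the
squared norm of the Q-component. -/
theorem sq_add_sq_le (H : LocalVaisman h θ J s) (hy : y ∈ s) (u : E) :
    θ y u ^ 2 + θ y (J u) ^ 2 ≤ h y u u := by
  set w := u - θ y u • leeField h θ y + θ y (J u) • J (leeField h θ y) with hw
  have h1 : 0 ≤ h y w w := by
    rcases eq_or_ne w 0 with h0 | h0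
    · simp [h0]
    · exact (H.pos y hy w h0).le
  have h2 : h y w w = h y u u - (θ y u ^ 2 + θ y (J u) ^ 2) := by
    simp only [hw, map_add, map_sub, map_smul, add_apply, sub_apply, smul_apply, H.inner_lee hy,
      H.inner_lee' hy, H.inner_J_lee hy, H.inner_J_lee' hy, H.form_lee hy, H.form_J_lee hy, H.J_sq,
      map_neg, smul_eq_mul]
    ring
  linarith

/-- The deformation multiplies the squared norm of the Q-component by a and that of the vertical
component by a². -/
theorem deform_pos (H : LocalVaisman h θ J s) {a : ℝ} (ha : 0 < a) (hy : y ∈ s) {u : E}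
    (hu : u ≠ 0) : 0 < deform a (h y) (θ y) J u u := by
  have h1 := H.sq_add_sq_le hy u
  have h2 := H.pos y hy u hu
  rw [deform_apply]
  have h3 : a * h y u u + (a ^ 2 - a) * (θ y (J u) * θ y (J u) + θ y u * θ y u)
      = a * (h y u u - (θ y u ^ 2 + θ y (J u) ^ 2)) + a ^ 2 * (θ y u ^ 2 + θ y (J u) ^ 2) := by ring
  rw [h3]
  rcases h1.lt_or_eq with h4 | h4
  · have := mul_pos ha (sub_pos.2 h4)
    positivity
  · rw [h4, sub_self, mul_zero, zero_add]
    positivity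

theorem localMetric_deform (H : LocalVaisman h θ J s) {a : ℝ} (ha : 0 < a) :
    LocalMetric (fun z => deform a (h z) (θ z) J) s where
  isOpen := H.isOpen
  smooth := by
    intro y hy
    have h1 := H.contDiffAt hy
    have h2 := H.contDiffAt_form hy
    refine (contDiffAt_of_apply fun v => contDiffAt_of_apply fun w => ?_).contDiffWithinAt
    simp only [deform_apply]
    fun_prop
  symm := fun y hy u v => by
    rw [deform_apply, deform_apply, H.symm y hy u v]; ring
  pos := fun y hy u hu => H.deform_pos ha hy hu

theorem fderiv_deform (H : LocalVaisman h θ J s) {a : ℝ} (ha : 0 < a) (hy : y ∈ s) (u v w : E) :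
    fderiv ℝ (fun z => deform a (h z) (θ z) J) y u v w = a * fderiv ℝ h y u v w
      + (a ^ 2 - a) * (θ y (christoffelMap h y u (J v)) * θ y (J w)
        + θ y (J v) * θ y (christoffelMap h y u (J w))
        + θ y (christoffelMap h y u v) * θ y w + θ y v * θ y (christoffelMap h y u w)) := by
  have e1 := (H.localMetric_deform ha).lineDeriv_apply hy u v w
  have hθ : ∀ v, HasLineDerivAt ℝ (fun z => θ z v) _ y u := fun v =>
    lineDeriv_clm_apply (H.lineDeriv_form hy u) (lineDeriv_const v y u)
  have e2 := lineDeriv_add (lineDeriv_smul (lineDeriv_const a y u) (H.lineDeriv_apply hy u v w))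
    (lineDeriv_smul (lineDeriv_const (a ^ 2 - a) y u)
      (lineDeriv_add (lineDeriv_smul (hθ (J v)) (hθ (J w))) (lineDeriv_smul (hθ v) (hθ w))))
  have e3 := lineDeriv_eq_of_eventuallyEq e1 e2 (Filter.Eventually.of_forall fun z => by
    simp only [deform_apply, smul_eq_mul])
  rw [e3]
  simp only [map_zero, add_zero, H.fderiv_form hy, smul_eq_mul]
  ring

/-- On the vertical plane the metric scales by a² and the Lee form by a, so its dual vector scales
by 1/a. -/
theorem leeField_deform (H : LocalVaisman h θ J s) {a : ℝ} (ha : 0 < a) (hy : y ∈ s) :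
    leeField (fun z => deform a (h z) (θ z) J) (a • θ) y = a⁻¹ • leeField h θ y := by
  refine (eq_sharp (fun u hu => H.deform_pos ha hy hu) fun v => ?_).symm
  rw [deform_apply]
  simp only [map_smul, smul_apply, H.inner_lee hy, H.form_lee hy, H.form_J_lee hy, smul_eq_mul,
    Pi.smul_apply]
  field_simp
  ring

theorem antiLeeShape_deform (H : LocalVaisman h θ J s) {a : ℝ} (ha : 0 < a) (hy : y ∈ s) :
    antiLeeShape (fun z => deform a (h z) (θ z) J) (a • θ) J y = antiLeeShape h θ J y := by
  ext u
  have h1 : a * a⁻¹ = 1 := mul_inv_cancel₀ ha.ne'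
  simp only [antiLeeShape_apply, H.leeField_deform ha hy, Pi.smul_apply, smul_apply, map_smul,
    smul_smul, smul_eq_mul, mul_right_comm a _ a⁻¹, h1, one_mul]

theorem deform_shape (H : LocalVaisman h θ J s) (a : ℝ) (hy : y ∈ s) (u v : E) :
    deform a (h y) (θ y) J (antiLeeShape h θ J y u) v = a * h y (antiLeeShape h θ J y u) v := by
  rw [deform_apply, H.form_shape hy, H.form_J_shape hy]; ring

/-- In the Koszul formula θ ⊗ θ contributes no new tensor, θ being parallel, and θᶜ ⊗ θᶜ contributes
through ∇θᶜ = h(F·,·). The factor a² - a becomes a - 1 because the new metric is a times the old one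
on the image of F (`deform_shape`). -/
theorem christoffelMap_deform (H : LocalVaisman h θ J s) {a : ℝ} (ha : 0 < a) (hy : y ∈ s)
    (u v : E) : christoffelMap (fun z => deform a (h z) (θ z) J) y u v
      = christoffelMap h y u v + (a - 1) • (θ y (J v) • antiLeeShape h θ J y u
        + θ y (J u) • antiLeeShape h θ J y v) := by
  refine (H.localMetric_deform ha).christoffel_eq_of hy fun w => ?_
  simp only [H.fderiv_deform ha hy]
  simp only [map_add, map_smul, add_apply, smul_apply, H.deform_shape a hy, smul_eq_mul,
    H.form_christoffel_J hy, H.christoffel_symm hy v u, H.christoffel_symm hy w u,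
    H.christoffel_symm hy w v]
  rw [deform_apply, H.shape_skew hy w u, H.shape_skew hy w v, H.symm y hy w, H.symm y hy w,
    H.shape_skew hy v u, H.symm y hy v]
  linear_combination a * H.two_inner_christoffel hy u v w

theorem deform_localVaisman (H : LocalVaisman h θ J s) {a : ℝ} (ha : 0 < a) :
    LocalVaisman (fun z => deform a (h z) (θ z) J) (a • θ) J s where
  toLocalMetric := H.localMetric_deform ha
  smooth_form := H.smooth_form.const_smul a
  J_sq := H.J_sq
  hermitian := fun y hy u v => by
    simp only [deform_apply, H.hermitian y hy, H.J_sq, map_neg]; ring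
  -- The correction to Γ takes values in the image of F, which θ annihilates.
  parallel := fun y hy u v => by
    rw [← christoffelMap_apply, H.christoffelMap_deform ha hy, fderiv_const_smul_field]
    simp only [Pi.smul_apply, smul_apply, map_add, map_smul, H.form_shape hy, H.fderiv_form hy,
      smul_eq_mul]
    ring
  -- The new form is ω' = aω + (a² - a) θ ∧ θᶜ. Since dθᶜ = θ ∧ θᶜ - ω, its differential is a² θ ∧
  -- ω, which is (aθ) ∧ ω'.
  d_fundamental := fun y hy u v w => by
    have d := H.d_fundamental y hy u v w
    simp only [dTwoForm, wedgeOneTwo, fderiv_bilinPull_id (H.differentiableAt hy)] at d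
    simp only [dTwoForm, wedgeOneTwo,
      fderiv_bilinPull_id ((H.localMetric_deform ha).differentiableAt hy), H.fderiv_deform ha hy]
    simp only [bilinPull_id_eq, ContinuousLinearMap.comp_apply, ContinuousLinearMap.flip_apply,
      ContinuousLinearMap.compL_apply, deform_apply, Pi.smul_apply, smul_apply, H.J_sq, map_neg,
      smul_eq_mul] at d ⊢
    simp only [H.form_christoffel_J hy, H.christoffel_symm hy v u, H.christoffel_symm hy w u,
      H.christoffel_symm hy w v]
    simp only [H.inner_shape hy, H.J_sq, map_neg, H.inner_J_self_swap hy v u,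
      H.inner_J_self_swap hy w u, H.inner_J_self_swap hy w v] at d ⊢
    linear_combination a * d
  unit := fun y hy => by
    have := H.leeField_deform ha hy
    rw [leeField, Pi.smul_apply] at this
    simp only [Pi.smul_apply, this, smul_apply, map_smul, H.form_lee hy, smul_eq_mul]
    field_simp

/-- The symmetric part of `twist` is multiplied by a and so changes by minus the correction to Γ. In
its first term the factor a of the metric cancels the 1/a of U. -/
theorem adaptedMap_deform (H : LocalVaisman h θ J s) {a : ℝ} (ha : 0 < a) (hy : y ∈ s) :
    adaptedMap (fun z => deform a (h z) (θ z) J) (a • θ) J y = adaptedMap h θ J y := by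
  ext u v
  have h1 : a * a⁻¹ = 1 := mul_inv_cancel₀ ha.ne'
  simp only [adaptedMap, add_apply, H.christoffelMap_deform ha hy, twist_apply,
    H.antiLeeShape_deform ha hy, H.leeField_deform ha hy, H.deform_shape a hy, map_smul,
    Pi.smul_apply, smul_apply, smul_smul, smul_eq_mul]
  rw [show -(a * h y (antiLeeShape h θ J y u) v) * a⁻¹ = - h y (antiLeeShape h θ J y u) v by
    field_simp]
  module

theorem ricciForm_adaptedMap_deform (H : LocalVaisman h θ J s) {a : ℝ} (ha : 0 < a) (hy : y ∈ s)
    (v w : E) : ricciForm (adaptedMap (fun z => deform a (h z) (θ z) J) (a • θ) J) y v w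
      = ricciForm (adaptedMap h θ J) y v w := by
  have hE : adaptedMap (fun z => deform a (h z) (θ z) J) (a • θ) J =ᶠ[nhds y]
      adaptedMap h θ J := by
    filter_upwards [H.isOpen.mem_nhds hy] with z hz using H.adaptedMap_deform ha hz
  simp only [ricciForm, curvatureMap, hE.fderiv_eq, hE.eq_of_nhds]

end LocalVaisman

end Vaisman

/-! ### Einstein conditions at a point. -/

section Vaisman

variable {E : Type*} [NormedAddCommGroup E] [NormedSpace ℝ E] [FiniteDimensional ℝ E]
variable {h : E → E →L[ℝ] E →L[ℝ] ℝ} {θ : E → E →L[ℝ] ℝ} {J : E →L[ℝ] E} {s : Set E} {y : E}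

theorem christoffel_congr {h' : E → E →L[ℝ] E →L[ℝ] ℝ} (hh : h =ᶠ[nhds y] h') (u v : E) :
    christoffel h y u v = christoffel h' y u v := by
  simp only [christoffel, hh.fderiv_eq, hh.eq_of_nhds]

theorem dTwoForm_congr {Ω Ω' : E → E →L[ℝ] E →L[ℝ] ℝ} (hΩ : Ω =ᶠ[nhds y] Ω') (u v w : E) :
    dTwoForm Ω y u v w = dTwoForm Ω' y u v w := by
  simp only [dTwoForm, hΩ.fderiv_eq]

theorem ricciForm_congr {B B' : E → E →L[ℝ] E →L[ℝ] E} (hB : B =ᶠ[nhds y] B') (v w : E) :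
    ricciForm B y v w = ricciForm B' y v w := by
  simp only [ricciForm, curvatureMap, hB.fderiv_eq, hB.eq_of_nhds]

theorem ricciForm_add_right (B : E → E →L[ℝ] E →L[ℝ] E) (v w w' : E) :
    ricciForm B y v (w + w') = ricciForm B y v w + ricciForm B y v w' := by
  simp only [ricciForm]
  rw [← opTrace_add]
  refine congrArg opTrace (funext fun u => ?_)
  simp only [curvatureMap_apply, map_add]
  abel

theorem ricciForm_smul_right (B : E → E →L[ℝ] E →L[ℝ] E) (c : ℝ) (v w : E) :
    ricciForm B y v (c • w) = c * ricciForm B y v w := by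
  simp only [ricciForm]
  rw [← opTrace_smul]
  refine congrArg opTrace (funext fun u => ?_)
  simp only [curvatureMap_apply, map_smul]
  module

theorem adaptedMap_congr {h' : E → E →L[ℝ] E →L[ℝ] ℝ} {θ' : E → E →L[ℝ] ℝ}
    (hh : h =ᶠ[nhds y] h') (hθ : θ y = θ' y) (J : E →L[ℝ] E) :
    adaptedMap h θ J y = adaptedMap h' θ' J y := by
  ext u v
  simp only [adaptedMap, add_apply, twist_apply, christoffelMap_apply, antiLeeShape_apply,
    leeField, christoffel_congr hh, hh.eq_of_nhds, hθ]

namespace LocalVaisman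

/-- Chart expressions have their expected form only on the chart target, so a Vaisman structure must
pass to data agreeing with it there. -/
theorem congr (H : LocalVaisman h θ J s) {h' : E → E →L[ℝ] E →L[ℝ] ℝ} {θ' : E → E →L[ℝ] ℝ}
    (hh : ∀ z ∈ s, h' z = h z) (hθ : ∀ z ∈ s, θ' z = θ z) : LocalVaisman h' θ' J s := by
  have eh : ∀ z ∈ s, h' =ᶠ[nhds z] h := fun z hz => by
    filter_upwards [H.isOpen.mem_nhds hz] with q hq using hh q hq
  have eθ : ∀ z ∈ s, θ' =ᶠ[nhds z] θ := fun z hz => by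
    filter_upwards [H.isOpen.mem_nhds hz] with q hq using hθ q hq
  refine ⟨⟨H.isOpen, H.smooth.congr hh, fun y hy => ?_, fun y hy => ?_⟩, H.smooth_form.congr hθ,
    H.J_sq, fun y hy => ?_, fun y hy u v => ?_, fun y hy u v w => ?_, fun y hy => ?_⟩
  · rw [hh y hy]; exact H.symm y hy
  · rw [hh y hy]; exact H.pos y hy
  · rw [hh y hy]; exact H.hermitian y hy
  · rw [(eθ y hy).fderiv_eq, christoffel_congr (eh y hy), hθ y hy]; exact H.parallel y hy u v
  · have e : (fun z => bilinPull (h' z) (ContinuousLinearMap.id ℝ E) J) =ᶠ[nhds y]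
        fun z => bilinPull (h z) (ContinuousLinearMap.id ℝ E) J :=
      (eh y hy).fun_comp fun B => bilinPull B (ContinuousLinearMap.id ℝ E) J
    rw [dTwoForm_congr e, hh y hy, hθ y hy]; exact H.d_fundamental y hy u v w
  · rw [hh y hy, hθ y hy]; exact H.unit y hy

/-- The component of `v` orthogonal to the canonical foliation. -/
def _root_.VaismanGeometry.horizontal (h : E → E →L[ℝ] E →L[ℝ] ℝ) (θ : E → E →L[ℝ] ℝ)
    (J : E →L[ℝ] E) (y v : E) : E :=
  v - θ y v • leeField h θ y + θ y (J v) • J (leeField h θ y)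

theorem form_horizontal (H : LocalVaisman h θ J s) (hy : y ∈ s) (v : E) :
    θ y (horizontal h θ J y v) = 0 := by
  simp only [horizontal, map_add, map_sub, map_smul, H.form_lee hy, H.form_J_lee hy, smul_eq_mul]
  ring

theorem form_J_horizontal (H : LocalVaisman h θ J s) (hy : y ∈ s) (v : E) :
    θ y (J (horizontal h θ J y v)) = 0 := by
  simp only [horizontal, map_add, map_sub, map_smul, map_neg, H.J_sq, H.form_lee hy,
    H.form_J_lee hy, smul_eq_mul]
  ring

/-- Splitting `w` along Q, U and JU, the vertical part is evaluated by `ricciForm_lee` and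
`ricciForm_J_lee`. -/
theorem ricciForm_horizontal_right (H : LocalVaisman h θ J s) (hy : y ∈ s) (v w : E) :
    ricciForm (christoffelMap h) y v w
      = ricciForm (christoffelMap h) y v (horizontal h θ J y w)
        + ((Module.finrank ℝ E : ℝ) - 2) / 4 * (θ y (J v) * θ y (J w)) := by
  have e : w = horizontal h θ J y w + (θ y w • leeField h θ y
      + (- θ y (J w)) • J (leeField h θ y)) := by rw [horizontal]; module
  conv_lhs => rw [e]
  rw [ricciForm_add_right, ricciForm_add_right, ricciForm_smul_right, ricciForm_smul_right,
    H.ricciForm_lee hy, H.ricciForm_J_lee hy]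
  ring

theorem ricciForm_horizontal (H : LocalVaisman h θ J s) (hy : y ∈ s) (v w : E) :
    ricciForm (christoffelMap h) y v w
      = ricciForm (christoffelMap h) y (horizontal h θ J y v) (horizontal h θ J y w)
        + ((Module.finrank ℝ E : ℝ) - 2) / 4 * (θ y (J v) * θ y (J w)) := by
  rw [H.ricciForm_horizontal_right hy v w, H.ricciForm_symm hy v,
    H.ricciForm_horizontal_right hy _ v, H.form_J_horizontal hy, H.ricciForm_symm hy _ (horizontal h θ J y w)]
  ring

theorem inner_horizontal (H : LocalVaisman h θ J s) (hy : y ∈ s) (v w : E) :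
    h y v w = h y (horizontal h θ J y v) (horizontal h θ J y w)
      + (θ y v * θ y w + θ y (J v) * θ y (J w)) := by
  simp only [horizontal, map_add, map_sub, map_smul, add_apply, sub_apply, smul_apply,
    H.inner_lee hy, H.inner_lee' hy, H.inner_J_lee hy, H.inner_J_lee' hy, H.form_lee hy,
    H.form_J_lee hy, H.J_sq, map_neg, smul_eq_mul]
  ring

/-- The transverse Kähler-Einstein condition and the generalized quasi-Einstein condition agree. -/
theorem transverse_einstein_iff (H : LocalVaisman h θ J s) (hy : y ∈ s) (c : ℝ) :
    (∀ v w, θ y v = 0 → θ y (J v) = 0 → θ y w = 0 → θ y (J w) = 0 →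
      ricciForm (adaptedMap h θ J) y v w = (c + 1 / 2) * h y v w) ↔
    ∀ v w, ricciForm (christoffelMap h) y v w = c * h y v w
      + (((Module.finrank ℝ E : ℝ) - 2) / 4 - c) * (θ y (J v) * θ y (J w))
      + (-c) * (θ y v * θ y w) := by
  constructor
  · intro hT v w
    have e1 := hT _ _ (H.form_horizontal hy v) (H.form_J_horizontal hy v)
      (H.form_horizontal hy w) (H.form_J_horizontal hy w)
    rw [H.ricciForm_adaptedMap hy (H.form_horizontal hy v) (H.form_J_horizontal hy v)
      (H.form_horizontal hy w) (H.form_J_horizontal hy w)] at e1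
    rw [H.ricciForm_horizontal hy v w]
    -- Passing from the metric of the Q-components to the full metric puts `-c` in both the θ ⊗ θ
    -- and the θᶜ ⊗ θᶜ coefficient; the vertical Ricci curvature supplies the rest of the latter.
    linear_combination e1 - c * H.inner_horizontal hy v w
  · intro hR v w hv hv' hw hw'
    rw [H.ricciForm_adaptedMap hy hv hv' hw hw', hR, hv, hv']
    ring

/-- The Ricci contraction of the adapted connection is unchanged while the metric on Q is multiplied
by `a`; `hc` records this rescaling of the constant. -/
theorem transverse_einstein_deform (H : LocalVaisman h θ J s) (hy : y ∈ s) {a c c' : ℝ}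
    (ha : 0 < a) (hc : c + 1 / 2 = a * (c' + 1 / 2)) {h' : E → E →L[ℝ] E →L[ℝ] ℝ}
    {θ' : E → E →L[ℝ] ℝ} (hh : ∀ z ∈ s, h' z = deform a (h z) (θ z) J)
    (hθ : ∀ z ∈ s, θ' z = a • θ z)
    (hT : ∀ v w, θ y v = 0 → θ y (J v) = 0 → θ y w = 0 → θ y (J w) = 0 →
      ricciForm (adaptedMap h θ J) y v w = (c + 1 / 2) * h y v w) :
    ∀ v w, θ' y v = 0 → θ' y (J v) = 0 → θ' y w = 0 → θ' y (J w) = 0 →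
      ricciForm (adaptedMap h' θ' J) y v w = (c' + 1 / 2) * h' y v w := by
  intro v w hv hv' hw hw'
  have hB : adaptedMap h' θ' J =ᶠ[nhds y]
      adaptedMap (fun z => deform a (h z) (θ z) J) (a • θ) J := by
    filter_upwards [H.isOpen.mem_nhds hy] with z hz
    refine adaptedMap_congr ?_ (hθ z hz) J
    filter_upwards [H.isOpen.mem_nhds hz] with q hq using hh q hq
  have hz : ∀ u, θ' y u = 0 → θ y u = 0 := fun u hu => by
    rw [hθ y hy, smul_apply, smul_eq_mul] at hu
    exact (mul_eq_zero.1 hu).resolve_left ha.ne'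
  rw [ricciForm_congr hB, H.ricciForm_adaptedMap_deform ha hy,
    hT v w (hz v hv) (hz _ hv') (hz w hw) (hz _ hw'), hh y hy, deform_apply, hz v hv, hz _ hv', hc]
  ring

end LocalVaisman

/-! ### Change of coordinates -/

/-- Derivative of a pulled-back form. -/
theorem lineDeriv_pull_apply {F : Type*} [NormedAddCommGroup F] [NormedSpace ℝ F]
    {α : E → E →L[ℝ] F} {τ : E → E} (hα : DifferentiableAt ℝ α (τ y)) (hτ : ContDiffAt ℝ 2 τ y)
    (u v : E) :
    HasLineDerivAt ℝ (fun z => α (τ z) (fderiv ℝ τ z v))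
      (fderiv ℝ α (τ y) (fderiv ℝ τ y u) (fderiv ℝ τ y v)
        + α (τ y) (fderiv ℝ (fderiv ℝ τ) y u v)) y u := by
  have h1 : DifferentiableAt ℝ τ y := hτ.differentiableAt (by norm_num)
  have h2 : DifferentiableAt ℝ (fderiv ℝ τ) y :=
    (hτ.fderiv_right (m := 1) (by norm_num)).differentiableAt (by norm_num)
  have e1 : HasLineDerivAt ℝ (fun z => α (τ z)) (fderiv ℝ α (τ y) (fderiv ℝ τ y u)) y u :=
    (hα.hasFDerivAt.comp y h1.hasFDerivAt).hasLineDerivAt u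
  have e2 := lineDeriv_clm_apply (lineDeriv_of_differentiableAt h2 u) (lineDeriv_const v y u)
  simpa using lineDeriv_clm_apply e1 e2

theorem fderiv_pull_two {h' : E → E →L[ℝ] E →L[ℝ] ℝ} {τ : E → E} (hh : DifferentiableAt ℝ h y)
    (hh' : DifferentiableAt ℝ h' (τ y)) (hτ : ContDiffAt ℝ 2 τ y)
    (hpull : ∀ᶠ z in nhds y, h z = bilinPull (h' (τ z)) (fderiv ℝ τ z) (fderiv ℝ τ z))
    (u v w : E) :
    fderiv ℝ h y u v w = fderiv ℝ h' (τ y) (fderiv ℝ τ y u) (fderiv ℝ τ y v) (fderiv ℝ τ y w)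
      + h' (τ y) (fderiv ℝ (fderiv ℝ τ) y u v) (fderiv ℝ τ y w)
      + h' (τ y) (fderiv ℝ τ y v) (fderiv ℝ (fderiv ℝ τ) y u w) := by
  have h2 : DifferentiableAt ℝ (fderiv ℝ τ) y :=
    (hτ.fderiv_right (m := 1) (by norm_num)).differentiableAt (by norm_num)
  have e1 := lineDeriv_clm_apply (lineDeriv_clm_apply (lineDeriv_of_differentiableAt hh u)
    (lineDeriv_const v y u)) (lineDeriv_const w y u)
  have e2 := lineDeriv_clm_apply (lineDeriv_pull_apply hh' hτ u v)
    (lineDeriv_clm_apply (lineDeriv_of_differentiableAt h2 u) (lineDeriv_const w y u))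
  have e3 := lineDeriv_eq_of_eventuallyEq e1 e2 (by
    filter_upwards [hpull] with z hz
    rw [hz]; rfl)
  simpa using e3

theorem fderiv_pull_one {θ' : E → E →L[ℝ] ℝ} {τ : E → E} (hθ : DifferentiableAt ℝ θ y)
    (hθ' : DifferentiableAt ℝ θ' (τ y)) (hτ : ContDiffAt ℝ 2 τ y)
    (hpull : ∀ᶠ z in nhds y, θ z = (θ' (τ z)).comp (fderiv ℝ τ z)) (u v : E) :
    fderiv ℝ θ y u v = fderiv ℝ θ' (τ y) (fderiv ℝ τ y u) (fderiv ℝ τ y v)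
      + θ' (τ y) (fderiv ℝ (fderiv ℝ τ) y u v) := by
  have e1 := lineDeriv_clm_apply (lineDeriv_of_differentiableAt hθ u) (lineDeriv_const v y u)
  have e3 := lineDeriv_eq_of_eventuallyEq e1 (lineDeriv_pull_apply hθ' hτ u v) (by
    filter_upwards [hpull] with z hz
    rw [hz]; rfl)
  simpa using e3

/-- Second derivatives of `τ` enter each first derivative of the pulled-back metric. In the Koszul
combination they reduce, by symmetry, to 2h'(D²τ(u, v), ·). -/
theorem christoffel_pull {s' : Set E} {h' : E → E →L[ℝ] E →L[ℝ] ℝ} {τ : E → E}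
    (H : LocalMetric h s) (hy : y ∈ s) (H' : LocalMetric h' s') (hy' : τ y ∈ s')
    (hτ : ContDiffAt ℝ 2 τ y) (hsurj : Function.Surjective (fderiv ℝ τ y))
    (hpull : ∀ᶠ z in nhds y, h z = bilinPull (h' (τ z)) (fderiv ℝ τ z) (fderiv ℝ τ z)) (u v : E) :
    fderiv ℝ τ y (christoffel h y u v)
      = christoffel h' (τ y) (fderiv ℝ τ y u) (fderiv ℝ τ y v) + fderiv ℝ (fderiv ℝ τ) y u v := by
  refine H'.eq_of_inner hy' fun w' => ?_
  obtain ⟨w, rfl⟩ := hsurj w'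
  have hs : ∀ a b, fderiv ℝ (fderiv ℝ τ) y a b = fderiv ℝ (fderiv ℝ τ) y b a :=
    hτ.isSymmSndFDerivAt (by simp)
  have e0 : ∀ a, h y a w = h' (τ y) (fderiv ℝ τ y a) (fderiv ℝ τ y w) := fun a => by
    rw [hpull.self_of_nhds]; rfl
  have e1 := H.two_inner_christoffel hy u v w
  have e2 := H'.two_inner_christoffel hy' (fderiv ℝ τ y u) (fderiv ℝ τ y v) (fderiv ℝ τ y w)
  simp only [fderiv_pull_two (H.differentiableAt hy) (H'.differentiableAt hy') hτ hpull] at e1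
  rw [christoffelMap_apply] at e1 e2
  rw [e0, hs w u, hs w v, hs v u, H'.symm _ hy' (fderiv ℝ τ y u)] at e1
  rw [map_add, add_apply]
  linarith [H'.symm _ hy' (fderiv ℝ τ y v) (fderiv ℝ (fderiv ℝ τ) y u w)]

/-- The same second-derivative term of `τ` arises from ∂θ and from Γ, so the equation is invariant.
-/
theorem parallel_pull {s' : Set E} {h' : E → E →L[ℝ] E →L[ℝ] ℝ} {θ' : E → E →L[ℝ] ℝ} {τ : E → E}
    (H : LocalMetric h s) (hy : y ∈ s) (H' : LocalMetric h' s') (hy' : τ y ∈ s')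
    (hτ : ContDiffAt ℝ 2 τ y) (hsurj : Function.Surjective (fderiv ℝ τ y))
    (hpull : ∀ᶠ z in nhds y, h z = bilinPull (h' (τ z)) (fderiv ℝ τ z) (fderiv ℝ τ z))
    (hθ : DifferentiableAt ℝ θ y) (hθ' : DifferentiableAt ℝ θ' (τ y))
    (hpullθ : ∀ᶠ z in nhds y, θ z = (θ' (τ z)).comp (fderiv ℝ τ z))
    (hpar : ∀ u v, fderiv ℝ θ' (τ y) u v = θ' (τ y) (christoffel h' (τ y) u v)) (u v : E) :
    fderiv ℝ θ y u v = θ y (christoffel h y u v) := by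
  rw [fderiv_pull_one hθ hθ' hτ hpullθ, hpar, hpullθ.self_of_nhds, ContinuousLinearMap.comp_apply,
    christoffel_pull H hy H' hy' hτ hsurj hpull, map_add]

/-- Symmetric second derivatives of `τ` cancel against the alternating form. -/
theorem dTwoForm_pull {Ω Ω' : E → E →L[ℝ] E →L[ℝ] ℝ} {τ : E → E} (hΩ : DifferentiableAt ℝ Ω y)
    (hΩ' : DifferentiableAt ℝ Ω' (τ y)) (halt : ∀ u v, Ω' (τ y) u v = - Ω' (τ y) v u)
    (hτ : ContDiffAt ℝ 2 τ y)
    (hpull : ∀ᶠ z in nhds y, Ω z = bilinPull (Ω' (τ z)) (fderiv ℝ τ z) (fderiv ℝ τ z))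
    (u v w : E) :
    dTwoForm Ω y u v w
      = dTwoForm Ω' (τ y) (fderiv ℝ τ y u) (fderiv ℝ τ y v) (fderiv ℝ τ y w) := by
  have hs : ∀ a b, fderiv ℝ (fderiv ℝ τ) y a b = fderiv ℝ (fderiv ℝ τ) y b a :=
    hτ.isSymmSndFDerivAt (by simp)
  simp only [dTwoForm, fderiv_pull_two hΩ hΩ' hτ hpull]
  rw [hs w u, hs w v, hs v u, halt (fderiv ℝ τ y u), halt (fderiv ℝ τ y v)]
  ring

end Vaisman

/-! ### Transition maps and differentials of charts. -/

section Charts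

variable {E : Type*} [NormedAddCommGroup E] [NormedSpace ℂ E]
variable {M : Type*} [TopologicalSpace M] [ChartedSpace E M] [IsManifold 𝓘(ℂ, E) ω M]

variable (E) in
/-- Multiplication by `i`. -/
def mulI : E →L[ℝ] E := ((Complex.I : ℂ) • ContinuousLinearMap.id ℂ E).restrictScalars ℝ

theorem mulI_mulI (u : E) : mulI E (mulI E u) = -u := by
  simp [mulI, smul_smul]

/-- The transition map between two preferred charts. -/
def transition (x x' : M) : E → E := chartAt E x' ∘ (chartAt E x).symm

theorem mdifferentiableAt_chart_symm (x : M) {y : E} (hy : y ∈ (chartAt E x).target) :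
    MDifferentiableAt 𝓘(ℝ, E) 𝓘(ℝ, E) (chartAt E x).symm y :=
  ((contMDiffOn_chart_symm (I := 𝓘(ℝ, E)) (n := ∞) (x := x)).contMDiffAt
    ((chartAt E x).open_target.mem_nhds hy)).mdifferentiableAt (by simp)

theorem mdifferentiableAt_chart (x : M) {p : M} (hp : p ∈ (chartAt E x).source) :
    MDifferentiableAt 𝓘(ℝ, E) 𝓘(ℝ, E) (chartAt E x) p :=
  ((contMDiffOn_chart (I := 𝓘(ℝ, E)) (n := ∞) (x := x)).contMDiffAt
    ((chartAt E x).open_source.mem_nhds hp)).mdifferentiableAt (by simp)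

/-- `dChartSymm x y` as an endomorphism of the model space, through the identification of tangent
spaces with the model space. -/
def chartDeriv (x : M) (y : E) : E →L[ℝ] E := dChartSymm x y

/-- The tangent space at a point is identified with `E` by the preferred chart at that point. The
differential of an inverse chart is therefore that of a transition map whose target chart varies
with `y`. -/
theorem chartDeriv_eq_fderiv (x : M) {y : E} (hy : y ∈ (chartAt E x).target) :
    chartDeriv x y = fderiv ℝ (transition x ((chartAt E x).symm y)) y := by
  have h := mdifferentiableAt_chart_symm x hy
  simp only [chartDeriv, dChartSymm, mfderiv, h, if_true]
  simp [writtenInExtChartAt, transition]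
  rfl

theorem chartDeriv_self (x : M) :
    chartDeriv x (chartAt E x x) = ContinuousLinearMap.id ℝ E := by
  rw [chartDeriv_eq_fderiv x (mem_chart_target E x), (chartAt E x).left_inv (mem_chart_source E x)]
  have : transition x x =ᶠ[nhds (chartAt E x x)] id := by
    filter_upwards [(chartAt E x).open_target.mem_nhds (mem_chart_target E x)] with z hz
      using (chartAt E x).right_inv hz
  rw [this.fderiv_eq, fderiv_id]

theorem dChart_self (x : M) : (dChart x : E →L[ℝ] E) = ContinuousLinearMap.id ℝ E := by
  have h := mdifferentiableAt_chart x (mem_chart_source E x)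
  simp only [dChart, mfderiv, h, if_true]
  have : transition x x =ᶠ[nhds (chartAt E x x)] id := by
    filter_upwards [(chartAt E x).open_target.mem_nhds (mem_chart_target E x)] with z hz
      using (chartAt E x).right_inv hz
  have h2 := this.fderiv_eq (𝕜 := ℝ)
  rw [fderiv_id] at h2
  rw [← h2]
  simp [writtenInExtChartAt, transition]
  rfl

theorem contDiffAt_transition_complex (x x' : M) {y : E} (hy : y ∈ (chartAt E x).target)
    (hy' : (chartAt E x).symm y ∈ (chartAt E x').source) :
    ContDiffAt ℂ ω (transition x x') y := by
  have h1 : ContMDiffAt 𝓘(ℂ, E) 𝓘(ℂ, E) ω (chartAt E x).symm y :=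
    (contMDiffOn_chart_symm (x := x)).contMDiffAt ((chartAt E x).open_target.mem_nhds hy)
  have h2 : ContMDiffAt 𝓘(ℂ, E) 𝓘(ℂ, E) ω (chartAt E x') ((chartAt E x).symm y) :=
    (contMDiffOn_chart (x := x')).contMDiffAt ((chartAt E x').open_source.mem_nhds hy')
  exact (h2.comp y h1).contDiffAt

theorem contDiffAt_transition (x x' : M) {y : E} (hy : y ∈ (chartAt E x).target)
    (hy' : (chartAt E x).symm y ∈ (chartAt E x').source) :
    ContDiffAt ℝ ∞ (transition x x') y :=
  ((contDiffAt_transition_complex x x' hy hy').restrict_scalars ℝ).of_le le_top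

theorem fderiv_transition_mulI (x x' : M) {y : E} (hy : y ∈ (chartAt E x).target)
    (hy' : (chartAt E x).symm y ∈ (chartAt E x').source) (u : E) :
    fderiv ℝ (transition x x') y (mulI E u) = mulI E (fderiv ℝ (transition x x') y u) := by
  have h := (contDiffAt_transition_complex x x' hy hy').differentiableAt (by simp)
  rw [h.fderiv_restrictScalars ℝ]
  simp [mulI]

/-- Holomorphic transition maps have complex-linear differentials. Hence J is constant in every
chart, which is how integrability is used. -/
theorem chartDeriv_mulI (x : M) {y : E} (hy : y ∈ (chartAt E x).target) (u : E) :
    chartDeriv x y (mulI E u) = mulI E (chartDeriv x y u) := by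
  rw [chartDeriv_eq_fderiv x hy]
  exact fderiv_transition_mulI x _ hy (mem_chart_source E _) u

theorem chartDeriv_comp (x x' : M) {y : E} (hy : y ∈ (chartAt E x).target)
    (hy' : (chartAt E x).symm y ∈ (chartAt E x').source) :
    chartDeriv x y
      = (chartDeriv x' (transition x x' y)).comp (fderiv ℝ (transition x x') y) := by
  have hτ : transition x x' y ∈ (chartAt E x').target := (chartAt E x').map_source hy'
  have hp : (chartAt E x').symm (transition x x' y) = (chartAt E x).symm y :=
    (chartAt E x').left_inv hy'
  rw [chartDeriv_eq_fderiv x hy, chartDeriv_eq_fderiv x' hτ, hp]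
  set p := (chartAt E x).symm y with hpd
  have h1 : DifferentiableAt ℝ (transition x' p) (transition x x' y) :=
    (contDiffAt_transition x' p hτ (by rw [hp]; exact mem_chart_source E p)).differentiableAt
      (by simp)
  have h2 : DifferentiableAt ℝ (transition x x') y :=
    (contDiffAt_transition x x' hy hy').differentiableAt (by simp)
  rw [← fderiv_comp y h1 h2]
  refine Filter.EventuallyEq.fderiv_eq ?_
  have ho : IsOpen ((chartAt E x).target ∩ (chartAt E x).symm ⁻¹' (chartAt E x').source) :=
    (chartAt E x).isOpen_inter_preimage_symm (chartAt E x').open_source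
  filter_upwards [ho.mem_nhds ⟨hy, hy'⟩] with z hz
  simp only [Function.comp_apply, transition]
  rw [(chartAt E x').left_inv hz.2]

theorem chartDeriv_bijective (x : M) {y : E} (hy : y ∈ (chartAt E x).target) :
    Function.Bijective (chartDeriv x y) := by
  set p := (chartAt E x).symm y with hp
  have hpx : p ∈ (chartAt E x).source := (chartAt E x).map_target hy
  have hpt := mem_chart_target E p
  have hτ : transition x p y = chartAt E p p := rfl
  have hτ' : transition p x (chartAt E p p) = y := by
    simp only [transition, Function.comp_apply]
    rw [(chartAt E p).left_inv (mem_chart_source E p), (chartAt E x).right_inv hy]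
  have hp' : (chartAt E p).symm (chartAt E p p) = p := (chartAt E p).left_inv (mem_chart_source E p)
  have e1 := chartDeriv_comp p x hpt (by rw [hp']; exact hpx)
  have e2 := chartDeriv_comp x p hy (mem_chart_source E p)
  rw [hτ', chartDeriv_self] at e1
  rw [hτ, chartDeriv_self, ContinuousLinearMap.id_comp] at e2
  have h1 : DifferentiableAt ℝ (transition x p) (transition p x (chartAt E p p)) := by
    rw [hτ']
    exact (contDiffAt_transition x p hy (mem_chart_source E p)).differentiableAt (by simp)
  have h2 : DifferentiableAt ℝ (transition p x) (transition x p y) :=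
    (contDiffAt_transition p x hpt (by rw [hp']; exact hpx)).differentiableAt (by simp)
  have h3 : DifferentiableAt ℝ (transition x p) y :=
    (contDiffAt_transition x p hy (mem_chart_source E p)).differentiableAt (by simp)
  have e3 : (fderiv ℝ (transition p x) (chartAt E p p)).comp (fderiv ℝ (transition x p) y)
      = ContinuousLinearMap.id ℝ E := by
    rw [← hτ, ← fderiv_comp y h2 h3, ← fderiv_id (x := y)]
    refine Filter.EventuallyEq.fderiv_eq ?_
    have ho : IsOpen ((chartAt E x).target ∩ (chartAt E x).symm ⁻¹' (chartAt E p).source) :=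
      (chartAt E x).isOpen_inter_preimage_symm (chartAt E p).open_source
    filter_upwards [ho.mem_nhds ⟨hy, mem_chart_source E p⟩] with z hz
    simp only [Function.comp_apply, transition, id]
    rw [(chartAt E p).left_inv hz.2, (chartAt E x).right_inv hz.1]
  constructor
  · intro u v huv
    rw [e2] at huv
    have := congrArg (fderiv ℝ (transition p x) (chartAt E p p)) huv
    simpa [← ContinuousLinearMap.comp_apply, e3] using this
  · intro v
    exact ⟨_, (ContinuousLinearMap.ext_iff.1 e1 v).symm⟩

theorem fderiv_transition_surjective (x x' : M) {y : E} (hy : y ∈ (chartAt E x).target)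
    (hy' : (chartAt E x).symm y ∈ (chartAt E x').source) :
    Function.Surjective (fderiv ℝ (transition x x') y) := by
  intro v
  obtain ⟨u, hu⟩ := (chartDeriv_bijective x hy).2
    ((chartDeriv x' (transition x x' y)) v)
  refine ⟨u, (chartDeriv_bijective x' ((chartAt E x').map_source hy')).1 ?_⟩
  rw [chartDeriv_comp x x' hy hy'] at hu
  exact hu

end Charts

/-! ### Smooth sections and their coordinate expressions. -/

section Smoothness

variable {E : Type*} [NormedAddCommGroup E] [NormedSpace ℂ E]
variable {M : Type*} [TopologicalSpace M] [ChartedSpace E M] [IsManifold 𝓘(ℂ, E) ω M]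

theorem inChart₁_apply (α : OneForm E M) (x : M) (y u : E) :
    inChart₁ α x y u = α ((chartAt E x).symm y) (chartDeriv x y u) := rfl

theorem inChart₂_apply (g : BilinField E M) (x : M) (y u v : E) :
    inChart₂ g x y u v = g ((chartAt E x).symm y) (chartDeriv x y u) (chartDeriv x y v) := rfl

/-- Smoothness of tensor fields is defined through bundle trivializations, and their coordinate
expressions through chart differentials; this identifies the two. -/
theorem symm_trivializationAt_eq (x : M) {p : M} (hp : p ∈ (chartAt E x).source) (u : E) :
    (trivializationAt E (fun q : M => TangentSpace 𝓘(ℝ, E) q) x).symm p u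
      = (chartDeriv x (chartAt E x p) u : E) := by
  have : IsManifold 𝓘(ℝ, E) 1 M := IsManifold.of_le (n := ∞) (by simp)
  have h := TangentBundle.symmL_trivializationAt (I := 𝓘(ℝ, E)) hp
  have hb : p ∈ (trivializationAt E (fun q : M => TangentSpace 𝓘(ℝ, E) q) x).baseSet := by
    simpa using hp
  have h2 := (trivializationAt E (fun q : M => TangentSpace 𝓘(ℝ, E) q) x).symmL_apply (R := ℝ) hb u
  have h3 : mfderivWithin 𝓘(ℝ, E) 𝓘(ℝ, E) (extChartAt 𝓘(ℝ, E) x).symm (Set.range 𝓘(ℝ, E))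
        (extChartAt 𝓘(ℝ, E) x p)
      = mfderiv 𝓘(ℝ, E) 𝓘(ℝ, E) (chartAt E x).symm (chartAt E x p) := by
    rw [ModelWithCorners.range_eq_univ, mfderivWithin_univ]
    simp only [mfld_simps]
    rfl
  rw [h3] at h
  rw [← h2]
  exact congrArg (fun L : E →L[ℝ] E => L u) h

theorem contMDiffOn_source_iff {F : Type*} [NormedAddCommGroup F] [NormedSpace ℝ F] (x : M)
    (f : E → F) :
    ContMDiffOn 𝓘(ℝ, E) 𝓘(ℝ, F) ∞ (fun p : M => f (chartAt E x p)) (chartAt E x).source ↔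
      ContDiffOn ℝ ∞ f (chartAt E x).target := by
  constructor
  · intro h
    have h1 := h.comp (contMDiffOn_chart_symm (I := 𝓘(ℝ, E)) (n := ∞) (x := x))
      (fun z hz => (chartAt E x).map_target hz)
    refine h1.contDiffOn.congr fun z hz => ?_
    simp only [Function.comp_apply, (chartAt E x).right_inv hz]
  · intro h
    exact h.contMDiffOn.comp (contMDiffOn_chart (I := 𝓘(ℝ, E)) (n := ∞) (x := x))
      (fun p hp => (chartAt E x).map_source hp)

theorem contMDiff_oneForm_iff (α : OneForm E M) :
    ContMDiff 𝓘(ℝ, E) (𝓘(ℝ, E).prod 𝓘(ℝ, E →L[ℝ] ℝ)) ∞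
      (fun x : M => TotalSpace.mk' (E →L[ℝ] ℝ)
        (E := fun x : M => TangentSpace 𝓘(ℝ, E) x →L[ℝ] Trivial M ℝ x) x (α x)) ↔
    ∀ x, ContDiffOn ℝ ∞ (inChart₁ α x) (chartAt E x).target := by
  have : IsManifold 𝓘(ℝ, E) 1 M := IsManifold.of_le (n := ∞) (by simp)
  have key : ∀ x p : M, p ∈ (chartAt E x).source →
      ((trivializationAt (E →L[ℝ] ℝ) (fun x : M => TangentSpace 𝓘(ℝ, E) x →L[ℝ] Trivial M ℝ x) x)
        ⟨p, α p⟩).2 = inChart₁ α x (chartAt E x p) := by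
    intro x p hp
    have hb : p ∈ (trivializationAt E (fun q : M => TangentSpace 𝓘(ℝ, E) q) x).baseSet := by
      simpa using hp
    ext u
    have e1 : α p ((trivializationAt E (fun q : M => TangentSpace 𝓘(ℝ, E) q) x).symm p u)
        = α p (chartDeriv x (chartAt E x p) u : E) := by rw [symm_trivializationAt_eq x hp u]
    rw [inChart₁_apply, (chartAt E x).left_inv hp, ← e1, hom_trivializationAt_apply]
    simp [ContinuousLinearMap.inCoordinates, Trivialization.symmL_apply _ hb]
  have hbase : ∀ x p : M, p ∈ (chartAt E x).source →
      p ∈ (trivializationAt (E →L[ℝ] ℝ)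
        (fun x : M => TangentSpace 𝓘(ℝ, E) x →L[ℝ] Trivial M ℝ x) x).baseSet := fun x p hp => by
    simpa using hp
  constructor
  · intro h x
    rw [← contMDiffOn_source_iff]
    intro p hp
    have h1 := (Trivialization.contMDiffAt_section_iff _ (hbase x p hp)).1 (h p)
    refine (h1.congr_of_eventuallyEq ?_).contMDiffWithinAt
    filter_upwards [(chartAt E x).open_source.mem_nhds hp] with q hq using (key x q hq).symm
  · intro h x
    have hx := mem_chart_source E x
    refine (Trivialization.contMDiffAt_section_iff _ (hbase x x hx)).2 ?_
    refine (((contMDiffOn_source_iff x _).2 (h x)).contMDiffAt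
      ((chartAt E x).open_source.mem_nhds hx)).congr_of_eventuallyEq ?_
    filter_upwards [(chartAt E x).open_source.mem_nhds hx] with q hq using key x q hq

theorem contMDiff_bilinField_iff (g : BilinField E M) :
    ContMDiff 𝓘(ℝ, E) (𝓘(ℝ, E).prod 𝓘(ℝ, E →L[ℝ] E →L[ℝ] ℝ)) ∞
      (fun x : M => TotalSpace.mk' (E →L[ℝ] E →L[ℝ] ℝ)
        (E := fun x : M => TangentSpace 𝓘(ℝ, E) x →L[ℝ] TangentSpace 𝓘(ℝ, E) x →L[ℝ] ℝ) x (g x)) ↔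
    ∀ x, ContDiffOn ℝ ∞ (inChart₂ g x) (chartAt E x).target := by
  have : IsManifold 𝓘(ℝ, E) 1 M := IsManifold.of_le (n := ∞) (by simp)
  have key : ∀ x p : M, p ∈ (chartAt E x).source →
      ((trivializationAt (E →L[ℝ] E →L[ℝ] ℝ) (fun x : M => TangentSpace 𝓘(ℝ, E) x →L[ℝ]
        TangentSpace 𝓘(ℝ, E) x →L[ℝ] ℝ) x) ⟨p, g p⟩).2 = inChart₂ g x (chartAt E x p) := by
    intro x p hp
    have hb : p ∈ (trivializationAt E (fun q : M => TangentSpace 𝓘(ℝ, E) q) x).baseSet := by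
      simpa using hp
    ext u v
    have e1 : ∀ u, ((trivializationAt E (fun q : M => TangentSpace 𝓘(ℝ, E) q) x).symm p u)
        = (chartDeriv x (chartAt E x p) u : E) := symm_trivializationAt_eq x hp
    rw [inChart₂_apply, (chartAt E x).left_inv hp, ← e1, ← e1, hom_trivializationAt_apply]
    have e2 := inCoordinates_apply_eq₂ (𝕜 := ℝ) (F₁ := E) (F₂ := E) (F₃ := ℝ)
      (E₁ := fun q : M => TangentSpace 𝓘(ℝ, E) q) (E₂ := fun q : M => TangentSpace 𝓘(ℝ, E) q)
      (E₃ := Trivial M ℝ) (x₀ := x) (ϕ := g p) (v := u) (w := v) hb hb (Set.mem_univ _)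
    refine Eq.trans e2 ?_
    simp
  have hbase : ∀ x p : M, p ∈ (chartAt E x).source →
      p ∈ (trivializationAt (E →L[ℝ] E →L[ℝ] ℝ) (fun x : M => TangentSpace 𝓘(ℝ, E) x →L[ℝ]
        TangentSpace 𝓘(ℝ, E) x →L[ℝ] ℝ) x).baseSet := fun x p hp => by
    simpa using hp
  constructor
  · intro h x
    rw [← contMDiffOn_source_iff]
    intro p hp
    have h1 := (Trivialization.contMDiffAt_section_iff _ (hbase x p hp)).1 (h p)
    refine (h1.congr_of_eventuallyEq ?_).contMDiffWithinAt
    filter_upwards [(chartAt E x).open_source.mem_nhds hp] with q hq using (key x q hq).symm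
  · intro h x
    have hx := mem_chart_source E x
    refine (Trivialization.contMDiffAt_section_iff _ (hbase x x hx)).2 ?_
    refine (((contMDiffOn_source_iff x _).2 (h x)).contMDiffAt
      ((chartAt E x).open_source.mem_nhds hx)).congr_of_eventuallyEq ?_
    filter_upwards [(chartAt E x).open_source.mem_nhds hx] with q hq using key x q hq

end Smoothness

/-! ### Vaisman structures and Ricci tensors in charts. -/

section ChartData

variable {E : Type*} [NormedAddCommGroup E] [NormedSpace ℂ E]
variable {M : Type*} [TopologicalSpace M] [ChartedSpace E M]

theorem bilinField_congr (g : BilinField E M) {p q : M} (h : p = q) (a b : E) :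
    g p a b = g q a b := by subst h; rfl

theorem oneForm_congr (α : OneForm E M) {p q : M} (h : p = q) (a : E) : α p a = α q a := by
  subst h; rfl

variable [IsManifold 𝓘(ℂ, E) ω M]

theorem inChart₁_self (α : OneForm E M) (x : M) (u : E) :
    inChart₁ α x (chartAt E x x) u = α x u := by
  rw [inChart₁_apply, chartDeriv_self]
  exact oneForm_congr α ((chartAt E x).left_inv (mem_chart_source E x)) u

theorem inChart₂_self (g : BilinField E M) (x : M) (u v : E) :
    inChart₂ g x (chartAt E x x) u v = g x u v := by
  rw [inChart₂_apply, chartDeriv_self]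
  exact bilinField_congr g ((chartAt E x).left_inv (mem_chart_source E x)) u v

theorem dChart_apply (x : M) (u : E) : (dChart x u : E) = u := by
  have h := congrArg (fun L : E →L[ℝ] E => L u) (dChart_self (E := E) x)
  exact h

theorem inChart₁_antiLee (θ : OneForm E M) (x : M) {y : E} (hy : y ∈ (chartAt E x).target) :
    inChart₁ (antiLee θ) x y = (inChart₁ θ x y).comp (mulI E) := by
  ext u
  rw [ContinuousLinearMap.comp_apply, inChart₁_apply, inChart₁_apply, chartDeriv_mulI x hy]
  rfl

theorem inChart₂_fundamentalForm (g : BilinField E M) (x : M) {y : E}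
    (hy : y ∈ (chartAt E x).target) :
    inChart₂ (fundamentalForm g) x y
      = bilinPull (inChart₂ g x y) (ContinuousLinearMap.id ℝ E) (mulI E) := by
  ext u v
  have e : bilinPull (inChart₂ g x y) (ContinuousLinearMap.id ℝ E) (mulI E) u v
    = inChart₂ g x y u (mulI E v) := rfl
  rw [e, inChart₂_apply, inChart₂_apply, chartDeriv_mulI x hy]
  rfl

theorem eventually_mem_overlap (x x' : M) {y : E} (hy : y ∈ (chartAt E x).target)
    (hy' : (chartAt E x).symm y ∈ (chartAt E x').source) :
    ∀ᶠ z in nhds y, z ∈ (chartAt E x).target ∧ (chartAt E x).symm z ∈ (chartAt E x').source :=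
  ((chartAt E x).isOpen_inter_preimage_symm (chartAt E x').open_source).mem_nhds ⟨hy, hy'⟩

theorem inChart₁_transition (α : OneForm E M) (x x' : M) {y : E} (hy : y ∈ (chartAt E x).target)
    (hy' : (chartAt E x).symm y ∈ (chartAt E x').source) :
    inChart₁ α x y = (inChart₁ α x' (transition x x' y)).comp (fderiv ℝ (transition x x') y) := by
  ext u
  rw [ContinuousLinearMap.comp_apply, inChart₁_apply, inChart₁_apply, chartDeriv_comp x x' hy hy']
  exact oneForm_congr α ((chartAt E x').left_inv hy').symm _

theorem inChart₂_transition (g : BilinField E M) (x x' : M) {y : E}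
    (hy : y ∈ (chartAt E x).target) (hy' : (chartAt E x).symm y ∈ (chartAt E x').source) :
    inChart₂ g x y = bilinPull (inChart₂ g x' (transition x x' y))
      (fderiv ℝ (transition x x') y) (fderiv ℝ (transition x x') y) := by
  ext u v
  have e : bilinPull (inChart₂ g x' (transition x x' y))
      (fderiv ℝ (transition x x') y) (fderiv ℝ (transition x x') y) u v
    = inChart₂ g x' (transition x x' y) (fderiv ℝ (transition x x') y u)
        (fderiv ℝ (transition x x') y v) := rfl
  rw [e, inChart₂_apply, inChart₂_apply, chartDeriv_comp x x' hy hy']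
  exact bilinField_congr g ((chartAt E x').left_inv hy').symm _ _

theorem chartDeriv_ne_zero (x : M) {y : E} (hy : y ∈ (chartAt E x).target) {u : E} (hu : u ≠ 0) :
    chartDeriv x y u ≠ 0 := fun h =>
  hu ((chartDeriv_bijective x hy).1 (by rw [h, map_zero]))

theorem localMetric_inChart (g : RMetric E M) (x : M) :
    LocalMetric (inChart₂ g.inner x) (chartAt E x).target where
  isOpen := (chartAt E x).open_target
  smooth := (contMDiff_bilinField_iff g.inner).1 g.contMDiff x
  symm := fun y _ u v => by
    rw [inChart₂_apply, inChart₂_apply]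
    exact g.symm ((chartAt E x).symm y) (chartDeriv x y u) (chartDeriv x y v)
  pos := fun y hy u hu => by
    rw [inChart₂_apply]
    exact g.pos ((chartAt E x).symm y) (chartDeriv x y u) (chartDeriv_ne_zero x hy hu)

variable [FiniteDimensional ℂ E]

theorem inChart_unit {g : BilinField E M} (θ : OneForm E M) (x : M) {y : E}
    (hy : y ∈ (chartAt E x).target)
    (hpos : ∀ u : E, u ≠ 0 → 0 < g ((chartAt E x).symm y) u u) :
    inChart₁ θ x y (sharp (inChart₂ g x y) (inChart₁ θ x y))
      = θ ((chartAt E x).symm y)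
        (sharp (E := E) (g ((chartAt E x).symm y)) (θ ((chartAt E x).symm y))) := by
  obtain ⟨z, hz⟩ := (chartDeriv_bijective x hy).2
    (sharp (E := E) (g ((chartAt E x).symm y)) (θ ((chartAt E x).symm y)))
  have h1 : z = sharp (inChart₂ g x y) (inChart₁ θ x y) := by
    refine eq_sharp (fun u hu => ?_) fun v => ?_
    · exact hpos _ (chartDeriv_ne_zero x hy hu)
    · rw [inChart₂_apply, inChart₁_apply, hz]
      exact sharp_spec (E := E) hpos _ _
  rw [← h1, inChart₁_apply, hz]

/-- Parallelism and dω = θ ∧ ω are given only at the centre of each preferred chart. At another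
point `y` of the chart at `x` they are pulled back from the preferred chart at the point with
coordinate `y`, which is centred there. -/
theorem IsVaisman.localVaisman {g : RMetric E M} {θ : OneForm E M} (hg : IsVaisman g θ)
    (hθ : IsUnitForm g.inner θ) (x : M) :
    LocalVaisman (inChart₂ g.inner x) (inChart₁ θ x) (mulI E) (chartAt E x).target := by
  have hM := localMetric_inChart g
  have hsm := (contMDiff_oneForm_iff θ).1 hg.smooth
  have hdθ : ∀ x : M, ∀ y ∈ (chartAt E x).target, DifferentiableAt ℝ (inChart₁ θ x) y :=
    fun x y hy => ((hsm x).contDiffAt ((chartAt E x).open_target.mem_nhds hy)).differentiableAt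
      (by simp)
  have hherm : ∀ x : M, ∀ y ∈ (chartAt E x).target, ∀ u v,
      inChart₂ g.inner x y (mulI E u) (mulI E v) = inChart₂ g.inner x y u v := fun x y hy u v => by
    rw [inChart₂_apply, inChart₂_apply, chartDeriv_mulI x hy, chartDeriv_mulI x hy]
    exact hg.hermitian _ _ _
  have hev : ∀ x : M, ∀ y ∈ (chartAt E x).target,
      inChart₂ (fundamentalForm g.inner) x =ᶠ[nhds y]
        fun z => bilinPull (inChart₂ g.inner x z) (ContinuousLinearMap.id ℝ E) (mulI E) :=
    fun x y hy => by
      filter_upwards [(chartAt E x).open_target.mem_nhds hy] with z hz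
        using inChart₂_fundamentalForm g.inner x hz
  have hdΩ : ∀ x : M, ∀ y ∈ (chartAt E x).target,
      DifferentiableAt ℝ (inChart₂ (fundamentalForm g.inner) x) y := fun x y hy => by
    refine DifferentiableAt.congr_of_eventuallyEq ?_ (hev x y hy)
    simp only [bilinPull_id_eq]
    exact (differentiableAt_const _).clm_comp ((hM x).differentiableAt hy)
  have halt : ∀ x : M, ∀ y ∈ (chartAt E x).target, ∀ u v,
      inChart₂ (fundamentalForm g.inner) x y u v
        = - inChart₂ (fundamentalForm g.inner) x y v u := fun x y hy u v => by
    have h1 := hherm x y hy u (mulI E v)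
    rw [mulI_mulI, map_neg, (hM x).symm y hy] at h1
    rw [inChart₂_fundamentalForm g.inner x hy]
    change inChart₂ g.inner x y u (mulI E v) = - inChart₂ g.inner x y v (mulI E u)
    linarith
  refine ⟨hM x, hsm x, mulI_mulI, hherm x, fun y hy u v => ?_, fun y hy u v w => ?_,
    fun y hy => ?_⟩
  · set p := (chartAt E x).symm y with hp
    have hps := mem_chart_source E p
    have hev' := eventually_mem_overlap x p hy hps
    exact parallel_pull (τ := transition x p) (hM x) hy (hM p) (mem_chart_target E p)
      ((contDiffAt_transition x p hy hps).of_le ENat.LEInfty.out)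
      (fderiv_transition_surjective x p hy hps)
      (by filter_upwards [hev'] with z hz using inChart₂_transition g.inner x p hz.1 hz.2)
      (hdθ x y hy) (hdθ p _ (mem_chart_target E p))
      (by filter_upwards [hev'] with z hz using inChart₁_transition θ x p hz.1 hz.2)
      (hg.parallel p) u v
  · set p := (chartAt E x).symm y with hp
    have hps := mem_chart_source E p
    have hev' := eventually_mem_overlap x p hy hps
    rw [← dTwoForm_congr (hev x y hy), ← inChart₂_fundamentalForm g.inner x hy,
      dTwoForm_pull (τ := transition x p) (hdΩ x y hy) (hdΩ p _ (mem_chart_target E p))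
        (halt p _ (mem_chart_target E p))
        ((contDiffAt_transition x p hy hps).of_le ENat.LEInfty.out)
        (by filter_upwards [hev'] with z hz using
          inChart₂_transition (fundamentalForm g.inner) x p hz.1 hz.2)]
    refine (hg.d_fundamentalForm p _ _ _).trans ?_
    rw [inChart₁_transition θ x p hy hps, inChart₂_transition (fundamentalForm g.inner) x p hy hps]
    rfl
  · rw [inChart_unit θ x hy fun u hu => g.pos _ _ hu]
    exact hθ _

section Ricci

variable {g : BilinField E M} {θ : OneForm E M} {x : M}

theorem ricci_eq (H : LocalMetric (inChart₂ g x) (chartAt E x).target) (v w : E) :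
    ricci g x v w = ricciForm (christoffelMap (inChart₂ g x)) (chartAt E x x) v w := by
  have e : ricci g x v w
      = ricciLocal (inChart₂ g x) (chartAt E x x) (dChart x v) (dChart x w) := rfl
  rw [e, ← H.ricciLocal_eq (mem_chart_target E x), dChart_apply, dChart_apply]

theorem ricciCanonical_eq
    (H : LocalVaisman (inChart₂ g x) (inChart₁ θ x) (mulI E) (chartAt E x).target) (v : E) {w : E}
    (hw : θ x w = 0) (hw' : antiLee θ x w = 0) :
    ricciCanonical g θ x v w
      = ricciForm (adaptedMap (inChart₂ g x) (inChart₁ θ x) (mulI E)) (chartAt E x x) v w := by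
  have hw1 : inChart₁ θ x (chartAt E x x) w = 0 := by rw [inChart₁_self, hw]
  have hw2 : inChart₁ θ x (chartAt E x x) (mulI E w) = 0 := by rw [inChart₁_self]; exact hw'
  have e : ricciCanonical g θ x v w = transverseRicciLocal (inChart₂ g x)
      (projPlane (inChart₂ g x) (inChart₁ θ x) (inChart₁ (antiLee θ) x))
      (chartAt E x x) (dChart x v) (dChart x w) := rfl
  rw [e, ← H.transverseRicci_plane (mem_chart_target E x)
    (fun z hz v => H.projPlane_eq hz (inChart₁_antiLee θ x hz) v) v hw1 hw2,
    dChart_apply, dChart_apply]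

theorem ricciLee_eq
    (H : LocalVaisman (inChart₂ g x) (inChart₁ θ x) (mulI E) (chartAt E x).target) (v : E) {w : E}
    (hw : θ x w = 0) :
    ricciLee g θ x v w = ricciForm (christoffelMap (inChart₂ g x)) (chartAt E x x) v w := by
  have hw1 : inChart₁ θ x (chartAt E x x) w = 0 := by rw [inChart₁_self, hw]
  have e : ricciLee g θ x v w = transverseRicciLocal (inChart₂ g x)
      (projLine (inChart₂ g x) (inChart₁ θ x)) (chartAt E x x) (dChart x v) (dChart x w) := rfl
  rw [e, ← H.transverseRicci_line (mem_chart_target E x) v hw1, dChart_apply,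
    dChart_apply]

theorem isTransverseKahlerEinstein_iff
    (H : ∀ x, LocalVaisman (inChart₂ g x) (inChart₁ θ x) (mulI E) (chartAt E x).target) (c : ℝ) :
    IsTransverseKahlerEinstein g θ c ↔ ∀ x, ∀ v w, inChart₁ θ x (chartAt E x x) v = 0 →
      inChart₁ θ x (chartAt E x x) (mulI E v) = 0 → inChart₁ θ x (chartAt E x x) w = 0 →
      inChart₁ θ x (chartAt E x x) (mulI E w) = 0 →
      ricciForm (adaptedMap (inChart₂ g x) (inChart₁ θ x) (mulI E)) (chartAt E x x) v w
        = c * inChart₂ g x (chartAt E x x) v w := by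
  refine forall_congr' fun x => forall_congr' fun (v : E) => forall_congr' fun (w : E) => ?_
  rw [inChart₁_self, inChart₁_self, inChart₁_self, inChart₁_self, inChart₂_self]
  constructor
  · intro h hv hv' hw hw'
    rw [← ricciCanonical_eq (H x) v hw hw']
    exact h hv hv' hw hw'
  · intro h hv hv' hw hw'
    rw [ricciCanonical_eq (H x) v hw hw']
    exact h hv hv' hw hw'

theorem isGeneralizedQuasiEinstein_iff
    (H : ∀ x, LocalVaisman (inChart₂ g x) (inChart₁ θ x) (mulI E) (chartAt E x).target)
    (c α β : ℝ) :
    IsGeneralizedQuasiEinstein g θ c α β ↔ ∀ x, ∀ v w,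
      ricciForm (christoffelMap (inChart₂ g x)) (chartAt E x x) v w
        = c * inChart₂ g x (chartAt E x x) v w
          + α * (inChart₁ θ x (chartAt E x x) (mulI E v) * inChart₁ θ x (chartAt E x x) (mulI E w))
          + β * (inChart₁ θ x (chartAt E x x) v * inChart₁ θ x (chartAt E x x) w) := by
  refine forall_congr' fun x => forall_congr' fun (v : E) => forall_congr' fun (w : E) => ?_
  rw [ricci_eq (H x).toLocalMetric v w, inChart₁_self, inChart₁_self, inChart₁_self,
    inChart₁_self, inChart₂_self]
  rfl

end Ricci

end ChartData

/-! ### The deformed metric on the manifold. -/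

section Deformation

variable {E : Type*} [NormedAddCommGroup E] [NormedSpace ℂ E] [FiniteDimensional ℂ E]
variable {M : Type*} [TopologicalSpace M] [ChartedSpace E M] [IsManifold 𝓘(ℂ, E) ω M]

/-- The tensor field `a g + (a² - a)(θᶜ ⊗ θᶜ + θ ⊗ θ)`. -/
def deformField (a : ℝ) (g : BilinField E M) (θ : OneForm E M) : BilinField E M := fun x =>
  deform (E := E) a (g x) (θ x) (mulI E)

theorem deformField_apply (a : ℝ) (g : BilinField E M) (θ : OneForm E M) (x : M) (v w : E) :
    deformField a g θ x v w = a * g x v w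
      + (a ^ 2 - a) * (θ x (mulI E v) * θ x (mulI E w) + θ x v * θ x w) :=
  deform_apply (E := E) a (g x) (θ x) (mulI E) v w

theorem inChart₂_deformField (a : ℝ) (g : BilinField E M) (θ : OneForm E M) (x : M) {y : E}
    (hy : y ∈ (chartAt E x).target) :
    inChart₂ (deformField a g θ) x y = deform a (inChart₂ g x y) (inChart₁ θ x y) (mulI E) := by
  ext u v
  rw [deform_apply, inChart₂_apply, inChart₂_apply, inChart₁_apply, inChart₁_apply, inChart₁_apply,
    inChart₁_apply, chartDeriv_mulI x hy, chartDeriv_mulI x hy]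
  exact deformField_apply a g θ _ _ _

variable {g : RMetric E M} {θ : OneForm E M}

/-- The scaling factors are a on Q and a² on the vertical plane, so the smaller of them gives a
lower bound. It yields positivity and bounded unit balls for the new metric. -/
theorem le_deformField (hg : IsVaisman g θ) (hθ : IsUnitForm g.inner θ) (a : ℝ)
    (x : M) (u : E) : min a (a ^ 2) * g.inner x u u ≤ deformField a g.inner θ x u u := by
  have H := hg.localVaisman hθ x
  have h1 := H.sq_add_sq_le (mem_chart_target E x) u
  rw [inChart₁_self, inChart₁_self, inChart₂_self] at h1
  rw [deformField_apply]
  have h2 : min a (a ^ 2) ≤ a := min_le_left _ _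
  have h3 : min a (a ^ 2) ≤ a ^ 2 := min_le_right _ _
  have h4 := mul_nonneg (sub_nonneg.2 h2) (sub_nonneg.2 h1)
  have h5 := mul_nonneg (sub_nonneg.2 h3)
    (add_nonneg (sq_nonneg (θ x u)) (sq_nonneg (θ x (mulI E u))))
  linarith

/-- The `Q`-homothetic deformation of a Vaisman metric. -/
def deformMetric (hg : IsVaisman g θ) (hθ : IsUnitForm g.inner θ) {a : ℝ} (ha : 0 < a) :
    RMetric E M where
  inner := deformField a g.inner θ
  symm x (u : E) (v : E) := by
    rw [deformField_apply, deformField_apply, g.symm x u v]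
    ring
  pos x (u : E) hu := by
    have h1 := le_deformField hg hθ a x u
    have h2 : 0 < min a (a ^ 2) := lt_min ha (by positivity)
    exact (mul_pos h2 (g.pos x u hu)).trans_le h1
  isVonNBounded x := by
    have hm : 0 < min a (a ^ 2) := lt_min ha (by positivity)
    set r := Real.sqrt (min a (a ^ 2)) with hr
    have hr0 : 0 < r := Real.sqrt_pos.2 hm
    have hr2 : r * r = min a (a ^ 2) := Real.mul_self_sqrt hm.le
    -- By the lower bound the new unit ball lies in r⁻¹ times the unit ball of `g`, a linear image
    -- of a bounded set.
    have h1 := (g.isVonNBounded x).image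
      (r⁻¹ • ContinuousLinearMap.id ℝ (TangentSpace 𝓘(ℝ, E) x))
    refine h1.subset fun u hu => (Set.mem_image _ _ _).2 ⟨r • u, ?_, ?_⟩
    · have h2 := le_deformField hg hθ a x u
      have h3 : deformField a g.inner θ x u u < 1 := hu
      have h4 : g.inner x (r • u) (r • u) = r * r * g.inner x u u := by
        rw [map_smul, map_smul, smul_apply, smul_eq_mul, smul_eq_mul]; ring
      change g.inner x (r • u) (r • u) < 1
      rw [h4, hr2]
      exact h2.trans_lt h3
    · rw [smul_apply, ContinuousLinearMap.id_apply, smul_smul, inv_mul_cancel₀ hr0.ne', one_smul]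
  contMDiff := (contMDiff_bilinField_iff _).2 fun x =>
    ((hg.localVaisman hθ x).localMetric_deform ha).smooth.congr
      fun y hy => inChart₂_deformField a g.inner θ x hy

theorem deformMetric_localVaisman (hg : IsVaisman g θ) (hθ : IsUnitForm g.inner θ) {a : ℝ}
    (ha : 0 < a) (x : M) :
    LocalVaisman (inChart₂ (deformMetric hg hθ ha).inner x) (inChart₁ (a • θ) x) (mulI E)
      (chartAt E x).target :=
  ((hg.localVaisman hθ x).deform_localVaisman ha).congr
    (fun _ hz => inChart₂_deformField a g.inner θ x hz) fun _ _ => rfl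

theorem deformMetric_isUnitForm (hg : IsVaisman g θ) (hθ : IsUnitForm g.inner θ) {a : ℝ}
    (ha : 0 < a) : IsUnitForm (deformMetric hg hθ ha).inner (a • θ) := fun x => by
  have h1 := (deformMetric_localVaisman hg hθ ha x).unit _ (mem_chart_target E x)
  rw [inChart_unit (a • θ) x (mem_chart_target E x)
    fun u hu => (deformMetric hg hθ ha).pos _ _ hu] at h1
  have h2 : ∀ p, p = x → (a • θ) p (sharp (E := E) ((deformMetric hg hθ ha).inner p) ((a • θ) p)) = 1
      → (a • θ) x (sharp (E := E) ((deformMetric hg hθ ha).inner x) ((a • θ) x)) = 1 := by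
    rintro p rfl h; exact h
  exact h2 _ ((chartAt E x).left_inv (mem_chart_source E x)) h1

theorem deformMetric_isVaisman (hg : IsVaisman g θ) (hθ : IsUnitForm g.inner θ) {a : ℝ}
    (ha : 0 < a) : IsVaisman (deformMetric hg hθ ha) (a • θ) where
  hermitian x (u : E) (v : E) := by
    have h := (deformMetric_localVaisman hg hθ ha x).hermitian _ (mem_chart_target E x) u v
    rw [inChart₂_self, inChart₂_self] at h
    exact h
  smooth := (contMDiff_oneForm_iff _).2 fun x =>
    (deformMetric_localVaisman hg hθ ha x).smooth_form
  parallel x u v := (deformMetric_localVaisman hg hθ ha x).parallel _ (mem_chart_target E x) u v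
  d_fundamentalForm x u v w := by
    have h := (deformMetric_localVaisman hg hθ ha x).d_fundamental _ (mem_chart_target E x) u v w
    have hev : inChart₂ (fundamentalForm (deformMetric hg hθ ha).inner) x
        =ᶠ[nhds (chartAt E x x)] fun z => bilinPull (inChart₂ (deformMetric hg hθ ha).inner x z)
          (ContinuousLinearMap.id ℝ E) (mulI E) := by
      filter_upwards [(chartAt E x).open_target.mem_nhds (mem_chart_target E x)] with z hz
        using inChart₂_fundamentalForm _ x hz
    rw [dTwoForm_congr hev, hev.eq_of_nhds]
    exact h

theorem deformMetric_isTransverseKahlerEinstein (hg : IsVaisman g θ) (hθ : IsUnitForm g.inner θ)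
    {a c c' : ℝ} (ha : 0 < a) (hc : c + 1 / 2 = a * (c' + 1 / 2))
    (hT : IsTransverseKahlerEinstein g.inner θ (c + 1 / 2)) :
    IsTransverseKahlerEinstein (deformMetric hg hθ ha).inner (a • θ) (c' + 1 / 2) := by
  rw [isTransverseKahlerEinstein_iff (deformMetric_localVaisman hg hθ ha)]
  rw [isTransverseKahlerEinstein_iff (hg.localVaisman hθ)] at hT
  exact fun x => (hg.localVaisman hθ x).transverse_einstein_deform (mem_chart_target E x) ha hc
    (fun z hz => inChart₂_deformField a g.inner θ x hz) (fun z _ => rfl) (hT x)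

theorem isTransverseKahlerEinstein_iff_quasiEinstein {n : ℕ} (hdim : Module.finrank ℂ E = n + 1)
    (hg : IsVaisman g θ) (hθ : IsUnitForm g.inner θ) (c : ℝ) :
    IsTransverseKahlerEinstein g.inner θ (c + 1 / 2) ↔
      IsGeneralizedQuasiEinstein g.inner θ c ((n : ℝ) / 2 - c) (-c) := by
  have H := hg.localVaisman hθ
  rw [isTransverseKahlerEinstein_iff H, isGeneralizedQuasiEinstein_iff H]
  -- The real dimension is 2(n + 1).
  have hN : (((Module.finrank ℝ E : ℕ) : ℝ) - 2) / 4 = (n : ℝ) / 2 := by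
    rw [finrank_real_of_complex, hdim]
    push_cast
    ring
  refine forall_congr' fun x => ?_
  rw [(H x).transverse_einstein_iff (mem_chart_target E x) c, hN]

theorem IsGeneralizedQuasiEinstein.isQuasiEinstein {g : BilinField E M} {c α β : ℝ}
    (h : IsGeneralizedQuasiEinstein g θ c α β) (hα : α = 0) : IsQuasiEinstein g θ c β :=
  fun x v w => by rw [h x v w, hα, zero_mul, add_zero]

theorem IsQuasiEinstein.isEinsteinOnLeeComplement {g : BilinField E M} {c β : ℝ}
    (h : IsQuasiEinstein g θ c β) : IsEinsteinOnLeeComplement g θ c :=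
  fun x v w hv _ => by rw [h x v w, hv, zero_mul, mul_zero, add_zero]

theorem IsEinsteinOnLeeComplement.isLeeTransverseEinstein {c : ℝ}
    (h : IsEinsteinOnLeeComplement g.inner θ c) (hg : IsVaisman g θ) (hθ : IsUnitForm g.inner θ) :
    IsLeeTransverseEinstein g.inner θ c := fun x (v : E) (w : E) hv hw => by
  have H := hg.localVaisman hθ x
  rw [ricciLee_eq H v hw, ← ricci_eq H.toLocalMetric, h x v w hv hw]

end Deformation

end VaismanGeometry

end

/-! ### The theorem. -/

open VaismanGeometry
theorem mainTheorem4 {E : Type*} [NormedAddCommGroup E] [NormedSpace ℂ E] [FiniteDimensional ℂ E]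
    {M : Type*} [TopologicalSpace M] [ChartedSpace E M] [IsManifold 𝓘(ℂ, E) ω M]
    (n : ℕ) (hn : 1 ≤ n) (hdim : Module.finrank ℂ E = n + 1)
    (g : RMetric E M) (θ : OneForm E M)
    (hg : IsVaisman g θ) (hθ : IsUnitForm g.inner θ)
    (c : ℝ) (hc : 0 < c + 1 / 2) :
    (IsTransverseKahlerEinstein g.inner θ (c + 1 / 2) ↔
      IsGeneralizedQuasiEinstein g.inner θ c ((n : ℝ) / 2 - c) (-c)) ∧
    (IsTransverseKahlerEinstein g.inner θ (c + 1 / 2) →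
      ∃ a : ℝ, a = (2 * c + 1) / ((n : ℝ) + 1) ∧ 0 < a ∧
      ∃ g' : RMetric E M,
        IsQHomotheticDeformation g.inner g'.inner θ a ∧
        IsVaisman g' (a • θ) ∧
        IsUnitForm g'.inner (a • θ) ∧
        IsLeeTransverseEinstein g'.inner (a • θ) ((n : ℝ) / 2) ∧
        IsEinsteinOnLeeComplement g'.inner (a • θ) ((n : ℝ) / 2) ∧
        IsQuasiEinstein g'.inner (a • θ) ((n : ℝ) / 2) (-((n : ℝ) / 2))) := by
  refine ⟨isTransverseKahlerEinstein_iff_quasiEinstein hdim hg hθ c, fun hT => ?_⟩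
  have hn1 : (0 : ℝ) < (n : ℝ) + 1 := by positivity
  have ha : 0 < (2 * c + 1) / ((n : ℝ) + 1) := div_pos (by linarith) hn1
  have hV := deformMetric_isVaisman hg hθ ha
  have hU := deformMetric_isUnitForm hg hθ ha
  -- The value `c' = n / 2` is the one for which the θᶜ ⊗ θᶜ coefficient `n / 2 - c'` vanishes, and
  -- `a` solves c + 1/2 = a(c' + 1/2).
  have hT' := deformMetric_isTransverseKahlerEinstein (c' := (n : ℝ) / 2) hg hθ ha
    (by field_simp) hT
  have hQ := ((isTransverseKahlerEinstein_iff_quasiEinstein hdim hV hU _).1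
    hT').isQuasiEinstein (sub_self _)
  have hE := hQ.isEinsteinOnLeeComplement
  exact ⟨_, rfl, ha, deformMetric hg hθ ha, fun x (v : E) (w : E) => deformField_apply _ g.inner θ x v w, hV, hU,
    hE.isLeeTransverseEinstein hV hU, hE, hQ⟩
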